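/- Consider the class of equations \[ u_t+f(t)u_x+uu_x+h(t)u_{xxt}=0 \] for a real function $u=u(t,x)$, where the arbitrary elements $f$ and $h$ are real smooth functions on an open interval and $h$ vanishes nowhere. An admissible transformation of the class is a triple consisting of two equations of the class and a (local) point transformation $\tilde t=T(t,x,u)$, $\tilde x=X(t,x,u)$, $\tilde u=U(t,x,u)$ that is smooth with nonvanishing Jacobian on a domain (nonempty connected open set) and maps the first equation to the second one, i.e. its prolongation to the third-order jet space maps the manifold defined by the first equation to the one defined by the second. A usual equivalence transformation of the class is a transformation of $(t,x,u,f,h)$, with $h\neq0$, whose components for $(t,x,u)$ form a point transformation that does not depend on the arbitrary elements, and which maps each equation of the class to the equation of the class with the transformed arbitrary elements. Then the usual equivalence transformations of the class form a group $G^{\sim}_2$, which consists exactly of the transformations \[ \tilde t=\frac{\delta_1}{\delta_3}t+\delta_0,\quad \tilde x=\delta_1x+\delta_2,\quad \tilde u=\delta_3u+\delta_4,\quad \tilde f=\delta_3f-\delta_4,\quad \tilde h=\delta_1^2h, \] where $\delta_0,\dots,\delta_4$ are arbitrary real constants with $\delta_1\delta_3\neq0$; equivalence transformations that are defined only over a domain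 of the space of $(t,x,u)$ are restrictions of these. Moreover, the class is normalized in the usual sense: each admissible transformation of the class is induced by an element of $G^{\sim}_2$, which means that, over the domain of the admissible transformation, its point transformation coincides with the $(t,x,u)$-components of the element, and the element maps the arbitrary elements of the first equation to those of the second one. -/

import Mathlib

open scoped ContDiff Topology

noncomputable section

namespace BBM

/-- Partial derivative with respect to the first variable `t` of a function of `(t, x)`. -/
def Dt (u : ℝ × ℝ → ℝ) : ℝ × ℝ → ℝ := fun p => fderiv ℝ u p (1, 0)

/-- Partial derivative with respect to the second variable `x` of a function of `(t, x)`. -/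
def Dx (u : ℝ × ℝ → ℝ) : ℝ × ℝ → ℝ := fun p => fderiv ℝ u p (0, 1)

/-- An equation `u_t + f(t) u_x + u u_x + h(t) u_xxt = 0` of the class: the coefficients `f` and `h`
are smooth on a nonempty open interval `I`, and `h` vanishes nowhere on `I`.
The values of `f` and `h` outside `I` are irrelevant. -/
structure Equation where
  I : Set ℝ
  isOpen_I : IsOpen I
  isConnected_I : IsConnected I
  f : ℝ → ℝ
  h : ℝ → ℝ
  smooth_f : ContDiffOn ℝ ∞ f I
  smooth_h : ContDiffOn ℝ ∞ h I
  h_ne_zero : ∀ t ∈ I, h t ≠ 0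

/-- The function `u` satisfies the equation `E` at the point `p = (t, x)`. -/
def Equation.HoldsAt (E : Equation) (u : ℝ × ℝ → ℝ) (p : ℝ × ℝ) : Prop :=
  Dt u p + E.f p.1 * Dx u p + u p * Dx u p + E.h p.1 * Dt (Dx (Dx u)) p = 0

/-- A (local) point transformation `(t, x, u) ↦ Φ (t, x, u)` on the set `Ω`:
it is smooth, with nonvanishing Jacobian determinant. -/
structure IsPointTransformation (Ω : Set (ℝ × ℝ × ℝ)) (Φ : ℝ × ℝ × ℝ → ℝ × ℝ × ℝ) : Prop where
  smooth : ContDiffOn ℝ ∞ Φ Ω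
  jacobian_ne_zero : ∀ z ∈ Ω, (fderiv ℝ Φ z).det ≠ 0

/-- Near the point `p` of the `(t, x)`-plane, `Φ` maps the graph of `u` into the graph of `v`. -/
def MapsGraphNear (Φ : ℝ × ℝ × ℝ → ℝ × ℝ × ℝ) (u v : ℝ × ℝ → ℝ) (p : ℝ × ℝ) : Prop :=
  ∀ᶠ q in 𝓝 p,
    v ((Φ (q.1, q.2, u q)).1, (Φ (q.1, q.2, u q)).2.1) = (Φ (q.1, q.2, u q)).2.2

/-- The point transformation `Φ`, considered over `Ω`, maps the equation `E` to the equation `E'`: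
the prolongation of `Φ` to the third-order jet space maps the manifold defined by `E` to the one
defined by `E'`. Jets over a point `(t, x, u)` of `Ω` are represented by germs of smooth functions
`u`, and `v` is the germ of the transformed function. (If the Jacobian of `Φ` does not vanish, then
such a `v` exists exactly when the prolongation of `Φ` is defined at the jet of `u`.) -/
def MapsEquation (Ω : Set (ℝ × ℝ × ℝ)) (Φ : ℝ × ℝ × ℝ → ℝ × ℝ × ℝ) (E E' : Equation) : Prop :=
  ∀ (u v : ℝ × ℝ → ℝ) (p p' : ℝ × ℝ),
    (p.1, p.2, u p) ∈ Ω →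
    p' = ((Φ (p.1, p.2, u p)).1, (Φ (p.1, p.2, u p)).2.1) →
    ContDiffAt ℝ ∞ u p → ContDiffAt ℝ ∞ v p' →
    MapsGraphNear Φ u v p →
    (E.HoldsAt u p ↔ E'.HoldsAt v p')

/-- `(E, E', Φ)` is an admissible transformation of the class, with `Φ` defined on the
domain (nonempty connected open set) `Ω`. -/
structure IsAdmissible (E E' : Equation) (Ω : Set (ℝ × ℝ × ℝ))
    (Φ : ℝ × ℝ × ℝ → ℝ × ℝ × ℝ) : Prop where
  isOpen : IsOpen Ω
  isConnected : IsConnected Ω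
  point : IsPointTransformation Ω Φ
  source : ∀ z ∈ Ω, z.1 ∈ E.I
  target : ∀ z ∈ Ω, (Φ z).1 ∈ E'.I
  maps : MapsEquation Ω Φ E E'

/-- The joint transformation
`(t, x, u) ↦ Φ (t, x, u)`, `(f, h) ↦ A (t, x, u) (f, h)`, with `(t, x, u)` in `Ω`, is a usual
equivalence transformation of the class: `Φ` is a point transformation that does not depend on the
arbitrary elements, and every equation `E` of the class is mapped to an equation `E'` of the class
whose arbitrary elements are the ones given by `A`. -/
structure IsUsualEquivalenceOn (Ω : Set (ℝ × ℝ × ℝ)) (Φ : ℝ × ℝ × ℝ → ℝ × ℝ × ℝ)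
    (A : ℝ × ℝ × ℝ → ℝ × ℝ → ℝ × ℝ) : Prop where
  point : IsPointTransformation Ω Φ
  maps : ∀ E : Equation, ∃ E' : Equation,
    (∀ z ∈ Ω, z.1 ∈ E.I → (Φ z).1 ∈ E'.I ∧
      A z (E.f z.1, E.h z.1) = (E'.f (Φ z).1, E'.h (Φ z).1)) ∧
    MapsEquation {z | z ∈ Ω ∧ z.1 ∈ E.I} Φ E E'

/-- The space of the independent variables, the dependent variable and the values of the
arbitrary elements, where `h ≠ 0`. -/
structure ExtSpace where
  t : ℝ
  x : ℝ
  u : ℝ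
  f : ℝ
  h : ℝ
  h_ne_zero : h ≠ 0

/-- An invertible transformation of the extended space is a usual equivalence transformation. -/
def IsUsualEquivalence (g : Equiv.Perm ExtSpace) : Prop :=
  ∃ (Φ : ℝ × ℝ × ℝ → ℝ × ℝ × ℝ) (A : ℝ × ℝ × ℝ → ℝ × ℝ → ℝ × ℝ),
    IsUsualEquivalenceOn Set.univ Φ A ∧
    ∀ p : ExtSpace,
      ((g p).t, (g p).x, (g p).u) = Φ (p.t, p.x, p.u) ∧
      ((g p).f, (g p).h) = A (p.t, p.x, p.u) (p.f, p.h)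

/-- The admissible transformation `(E, E', Φ)` on `Ω` is induced by `g`: over `Ω`, the components of
`g` for `(t, x, u)` are those of `Φ`, and `g` maps the arbitrary elements of `E` to those of `E'`. -/
def IsInducedBy (E E' : Equation) (Ω : Set (ℝ × ℝ × ℝ)) (Φ : ℝ × ℝ × ℝ → ℝ × ℝ × ℝ)
    (g : Equiv.Perm ExtSpace) : Prop :=
  ∀ p : ExtSpace, (p.t, p.x, p.u) ∈ Ω → p.f = E.f p.t → p.h = E.h p.t →
    ((g p).t, (g p).x, (g p).u) = Φ (p.t, p.x, p.u) ∧
    (g p).f = E'.f (g p).t ∧ (g p).h = E'.h (g p).t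

/-- The class is normalized in the usual sense: each admissible transformation is induced by an
element of the usual equivalence group. -/
def IsNormalized : Prop :=
  ∀ (E E' : Equation) (Ω : Set (ℝ × ℝ × ℝ)) (Φ : ℝ × ℝ × ℝ → ℝ × ℝ × ℝ),
    IsAdmissible E E' Ω Φ → ∃ g : Equiv.Perm ExtSpace, IsUsualEquivalence g ∧
      IsInducedBy E E' Ω Φ g

/-- The transformation `g` of the extended space is given by the formulas with the
parameters `δ₀, …, δ₄`. -/
def HasForm (g : Equiv.Perm ExtSpace) (δ₀ δ₁ δ₂ δ₃ δ₄ : ℝ) : Prop :=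
  ∀ p : ExtSpace,
    (g p).t = δ₁ / δ₃ * p.t + δ₀ ∧
    (g p).x = δ₁ * p.x + δ₂ ∧
    (g p).u = δ₃ * p.u + δ₄ ∧
    (g p).f = δ₃ * p.f - δ₄ ∧
    (g p).h = δ₁ ^ 2 * p.h

end BBM

end

/-! The core is that every admissible transformation `(T, X, U)` is affine with the stated
parameters; normalization and the description of the group both follow from it.

Step one shows `T = T(t)` and `X = X(x)` infinitesimally. The equation involves a single third-order
derivative, `u_txx`. Adding to `u` a binary cubic form at a point, without its `τ ξ²` term,
therefore keeps `u` on the source manifold. The transformed function changes by a nonzero multiple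
of that cubic composed with the inverse of the total differential of `(T, X)`, up to `o(r³)`
(`transformed_cubic_perturbation`). The target equation forces the `τ ξ²` coefficient of the new
cubic to vanish for all choices, so the total differential is diagonal
(`cross_total_derivatives_eq_zero`). Varying the 1-jet gives `T_x = T_u = X_t = X_u = 0`
(`partials_eq_zero`).

Step two writes the target equation in source jets (`determining`) and splits it at special jets.
The coefficients of `u_xx` and `u_tx` give `U_tu = U_uu = 0` and `2 X_x U_xu = X_xx U_u`. The
coefficient of `u_x` gives `(f' + U) T_t X_x h = h' (f + u)`, with primes marking the target
arbitrary elements. Differentiating this in `u` and `x` yields `X_xx = U_x = U_xu = 0`; the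
remaining coefficients give `U_t = 0` and `h' = X_x² h`. Then `U_u T_t = X_x`, whence `T_tt = 0`,
and all first partials are constant on the connected domain (`IsAdmissible.exists_form`).

Conversely, an affine transformation of this form multiplies the left-hand side of the equation by
the constant `δ₃² / δ₁` (`mapsEquation_transform`). For equivalence transformations, step two
applied to constant-coefficient equations already determines `Φ` and `A`, because these realize
every pair `(f, h)` with `h ≠ 0` at every point (`IsUsualEquivalenceOn.exists_form`). -/

noncomputable section

namespace BBM

open Filter Asymptotics

/-! ### Directional derivatives -/

section DirDeriv

variable {E F : Type*} [NormedAddCommGroup E] [NormedSpace ℝ E]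
  [NormedAddCommGroup F] [NormedSpace ℝ F]

/-- The derivative of `g` in the direction `v`, as a function of the point. -/
def dirDeriv (v : E) (g : E → ℝ) : E → ℝ := fun z => fderiv ℝ g z v

theorem dirDeriv_smooth {m n : WithTop ℕ∞} {g : E → ℝ} {z : E} (hg : ContDiffAt ℝ n g z)
    (hmn : m + 1 ≤ n) (v : E) : ContDiffAt ℝ m (dirDeriv v g) z :=
  (hg.fderiv_right hmn).clm_apply contDiffAt_const

theorem dirDeriv_smoothOn {g : E → ℝ} {Ω : Set E} (hΩ : IsOpen Ω) (hg : ContDiffOn ℝ ∞ g Ω)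
    (v : E) : ContDiffOn ℝ ∞ (dirDeriv v g) Ω := fun z hz =>
  (dirDeriv_smooth (hg.contDiffAt (hΩ.mem_nhds hz)) (by simp) v).contDiffWithinAt

theorem dirDeriv_comm {g : E → ℝ} {z : E} (hg : ContDiffAt ℝ 2 g z) (v w : E) :
    dirDeriv v (dirDeriv w g) z = dirDeriv w (dirDeriv v g) z := by
  have hd : DifferentiableAt ℝ (fderiv ℝ g) z :=
    (hg.fderiv_right (m := 1) (by norm_num)).differentiableAt (by simp)
  have key : ∀ a b : E, dirDeriv a (dirDeriv b g) z = fderiv ℝ (fderiv ℝ g) z a b := by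
    intro a b
    change fderiv ℝ (fun y => fderiv ℝ g y b) z a = _
    rw [fderiv_clm_apply hd (differentiableAt_const b)]
    simp
  rw [key, key]
  exact (hg.isSymmSndFDerivAt (by simp)) v w

theorem dirDeriv_congr {g₁ g₂ : E → ℝ} {z : E} (h : g₁ =ᶠ[𝓝 z] g₂) (v : E) :
    dirDeriv v g₁ =ᶠ[𝓝 z] dirDeriv v g₂ :=
  (h.fderiv (𝕜 := ℝ)).mono fun y hy => by simp only [dirDeriv, hy]

theorem dirDeriv_const (c : ℝ) (v z : E) : dirDeriv v (fun _ => c) z = 0 := by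
  simp [dirDeriv]

theorem dirDeriv_add {g₁ g₂ : E → ℝ} {z : E} (h₁ : DifferentiableAt ℝ g₁ z)
    (h₂ : DifferentiableAt ℝ g₂ z) (v : E) :
    dirDeriv v (fun y => g₁ y + g₂ y) z = dirDeriv v g₁ z + dirDeriv v g₂ z := by
  simp [dirDeriv, fderiv_fun_add h₁ h₂]

theorem dirDeriv_sub {g₁ g₂ : E → ℝ} {z : E} (h₁ : DifferentiableAt ℝ g₁ z)
    (h₂ : DifferentiableAt ℝ g₂ z) (v : E) :
    dirDeriv v (fun y => g₁ y - g₂ y) z = dirDeriv v g₁ z - dirDeriv v g₂ z := by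
  simp [dirDeriv, fderiv_fun_sub h₁ h₂]

theorem dirDeriv_mul {g₁ g₂ : E → ℝ} {z : E} (h₁ : DifferentiableAt ℝ g₁ z)
    (h₂ : DifferentiableAt ℝ g₂ z) (v : E) :
    dirDeriv v (fun y => g₁ y * g₂ y) z = dirDeriv v g₁ z * g₂ z + g₁ z * dirDeriv v g₂ z := by
  simp [dirDeriv, fderiv_fun_mul h₁ h₂]
  ring

theorem dirDeriv_real_comp {φ : ℝ → ℝ} {g : E → ℝ} {z : E} (hφ : DifferentiableAt ℝ φ (g z))
    (hg : DifferentiableAt ℝ g z) (v : E) :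
    dirDeriv v (fun y => φ (g y)) z = deriv φ (g z) * dirDeriv v g z := by
  have h := (hφ.hasDerivAt.comp_hasFDerivAt z hg.hasFDerivAt).fderiv
  simp only [dirDeriv]
  rw [show (fun y => φ (g y)) = φ ∘ g from rfl, h]
  simp

theorem dirDeriv_lin (a b : ℝ) (v w : E) (g : E → ℝ) (z : E) :
    dirDeriv (a • v + b • w) g z = a * dirDeriv v g z + b * dirDeriv w g z := by
  simp [dirDeriv]

end DirDeriv

/-! ### Third-order jets of functions that are `o(r³)` -/

/-- The third Taylor coefficient of a function of one variable that is `o(s³)` vanishes. -/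
theorem third_deriv_eq_zero {φ : ℝ → ℝ} (hφ : ContDiffAt ℝ 3 φ 0)
    (ho : φ =o[𝓝 0] fun s => s ^ 3) : deriv (deriv (deriv φ)) 0 = 0 := by
  obtain ⟨S, hS, hS'⟩ := hφ.contDiffOn (m := 3) le_rfl (by simp)
  obtain ⟨ε, hε, hεS⟩ := Metric.mem_nhds_iff.1 (by simpa using hS : S ∈ 𝓝 (0 : ℝ))
  set B := Metric.ball (0 : ℝ) ε
  have h0B : (0 : ℝ) ∈ B := Metric.mem_ball_self hε
  have hBo : IsOpen B := Metric.isOpen_ball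
  have hT := taylor_isLittleO (n := 3) (convex_ball (0 : ℝ) ε) h0B (hS'.mono hεS)
  rw [hBo.nhdsWithin_eq h0B] at hT
  simp only [sub_zero] at hT
  have hP : (fun s => taylorWithinEval φ 3 B 0 s) =o[𝓝 0] fun s : ℝ => s ^ 3 := by
    refine (ho.sub hT).congr_left fun s => ?_
    ring
  have hscale : ∀ c : ℝ, (fun s => taylorWithinEval φ 3 B 0 (c * s)) =o[𝓝 0]
      fun s : ℝ => s ^ 3 := by
    intro c
    have ht : Tendsto (fun s : ℝ => c * s) (𝓝 0) (𝓝 0) := by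
      have : Continuous fun s : ℝ => c * s := by fun_prop
      simpa using this.tendsto 0
    refine (hP.comp_tendsto ht).trans_isBigO ?_
    refine IsBigO.of_bound (|c| ^ 3) (Eventually.of_forall fun s => ?_)
    simp [mul_pow]
  -- The third finite difference `P(3s) - 3P(2s) + 3P(s) - P(0)` kills the Taylor terms of degree
  -- below three and multiplies the cubic coefficient by six, cancelling the `3!`.
  have hd := (((hscale 3).sub ((hscale 2).const_mul_left 3)).add
    ((hscale 1).const_mul_left 3)).sub (hscale 0)
  have h6 : (fun s : ℝ => iteratedDerivWithin 3 φ B 0 * s ^ 3) =o[𝓝 0] fun s : ℝ => s ^ 3 := by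
    refine hd.congr_left fun s => ?_
    simp only [taylor_within_apply, Finset.sum_range_succ, Finset.sum_range_zero, smul_eq_mul,
      sub_zero, Nat.factorial]
    norm_num
    ring
  have hz : iteratedDerivWithin 3 φ B 0 = 0 := by
    by_contra hne
    have h1 := (isLittleO_const_mul_left_iff hne).1 h6
    have h2 : Tendsto (fun s : ℝ => s ^ 3 / s ^ 3) (𝓝[≠] 0) (𝓝 0) :=
      (h1.mono nhdsWithin_le_nhds).tendsto_div_nhds_zero
    have h3 : Tendsto (fun s : ℝ => s ^ 3 / s ^ 3) (𝓝[≠] 0) (𝓝 1) := by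
      refine tendsto_const_nhds.congr' ?_
      filter_upwards [self_mem_nhdsWithin] with s hs
      rw [div_self (pow_ne_zero 3 hs)]
    exact zero_ne_one (tendsto_nhds_unique h2 h3)
  rw [iteratedDerivWithin_of_isOpen hBo h0B] at hz
  simpa [iteratedDeriv_succ, iteratedDeriv_zero] using hz

/-- Third directional derivatives vanish at a point where the function is `o(‖q - p‖³)`. -/
theorem third_dirDeriv_eq_zero {E : Type*} [NormedAddCommGroup E] [NormedSpace ℝ E]
    {g : E → ℝ} {p : E} (hg : ContDiffAt ℝ 3 g p)
    (ho : g =o[𝓝 p] fun q => ‖q - p‖ ^ 3) (y : E) :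
    dirDeriv y (dirDeriv y (dirDeriv y g)) p = 0 := by
  set l : ℝ → E := fun s => p + s • y with hl
  have hl0 : l 0 = p := by simp [hl]
  have hld : ∀ s, HasDerivAt l y s := fun s => by
    simpa [hl] using ((hasDerivAt_id s).smul_const y).const_add p
  have hlc : Continuous l := by fun_prop
  have hlt : Tendsto l (𝓝 0) (𝓝 p) := by simpa [hl0] using hlc.tendsto 0
  have hstep : ∀ (f : ℝ → ℝ) (k : E → ℝ), ContDiffAt ℝ 1 k p → f =ᶠ[𝓝 0] k ∘ l →
      deriv f =ᶠ[𝓝 0] dirDeriv y k ∘ l := by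
    intro f k hk hf
    have hev : ∀ᶠ s in 𝓝 (0 : ℝ), ContDiffAt ℝ 1 k (l s) :=
      hlt.eventually (hk.eventually (by simp))
    filter_upwards [hf.eventuallyEq_nhds, hev] with s hs hks
    rw [hs.deriv_eq]
    exact ((hks.differentiableAt (by simp)).hasFDerivAt.comp_hasDerivAt s (hld s)).deriv
  have h1 := hstep (g ∘ l) g (hg.of_le (by norm_num)) EventuallyEq.rfl
  have hg1 : ContDiffAt ℝ 2 (dirDeriv y g) p := dirDeriv_smooth hg (by norm_num) y
  have h2 := hstep _ _ (hg1.of_le (by norm_num)) h1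
  have h3 := hstep _ _ (dirDeriv_smooth hg1 (by norm_num) y) h2
  have hφ : ContDiffAt ℝ 3 (g ∘ l) 0 := by
    refine ContDiffAt.comp (0 : ℝ) (by rw [hl0]; exact hg) ?_
    simp only [hl]
    fun_prop
  have hφo : (g ∘ l) =o[𝓝 0] fun s : ℝ => s ^ 3 := by
    refine (ho.comp_tendsto hlt).trans_isBigO ?_
    refine IsBigO.of_bound (‖y‖ ^ 3) (Eventually.of_forall fun s => ?_)
    simp [hl, norm_smul, mul_pow, mul_comm]
  have := third_deriv_eq_zero hφ hφo
  rw [h3.self_of_nhds] at this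
  simpa [hl0] using this

theorem Dt_eq (u : ℝ × ℝ → ℝ) : Dt u = dirDeriv (1, 0) u := rfl

theorem Dx_eq (u : ℝ × ℝ → ℝ) : Dx u = dirDeriv (0, 1) u := rfl

theorem Dt_smooth {m n : WithTop ℕ∞} {u : ℝ × ℝ → ℝ} {p : ℝ × ℝ} (hu : ContDiffAt ℝ n u p)
    (h : m + 1 ≤ n) : ContDiffAt ℝ m (Dt u) p := dirDeriv_smooth hu h _

theorem Dx_smooth {m n : WithTop ℕ∞} {u : ℝ × ℝ → ℝ} {p : ℝ × ℝ} (hu : ContDiffAt ℝ n u p)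
    (h : m + 1 ≤ n) : ContDiffAt ℝ m (Dx u) p := dirDeriv_smooth hu h _

theorem fderiv_eq_zero_of_isLittleO {g : ℝ × ℝ → ℝ} {p : ℝ × ℝ}
    (ho : g =o[𝓝 p] fun q => ‖q - p‖ ^ 3) : g p = 0 ∧ fderiv ℝ g p = 0 := by
  have h0 : g p = 0 := by
    have := (ho.def (c := 1) one_pos).self_of_nhds
    simpa using this
  refine ⟨h0, HasFDerivAt.fderiv ?_⟩
  rw [hasFDerivAt_iff_isLittleO]
  have : (fun q => ‖q - p‖ ^ 3) =O[𝓝 p] fun q => q - p := by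
    have hb : ∀ᶠ q in 𝓝 p, ‖q - p‖ < 1 := by
      have : Tendsto (fun q => ‖q - p‖) (𝓝 p) (𝓝 0) := by
        have hc : Continuous fun q : ℝ × ℝ => ‖q - p‖ := by fun_prop
        simpa using hc.tendsto p
      exact this.eventually (gt_mem_nhds one_pos)
    refine IsBigO.of_bound 1 ?_
    filter_upwards [hb] with q hq
    have := norm_nonneg (q - p)
    rw [Real.norm_of_nonneg (by positivity), one_mul]
    exact pow_le_of_le_one this hq.le (by norm_num)
  simpa [h0] using ho.trans_isBigO this

/-- Polarization: the third derivatives along `(1, 1)` and `(1, -1)` add up to `2 g_ttt + 6 g_txx`,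
and the direction `(1, 0)` removes `g_ttt`. -/
theorem DtDxDx_eq_zero_of_isLittleO {g : ℝ × ℝ → ℝ} {p : ℝ × ℝ} (hg : ContDiffAt ℝ 3 g p)
    (ho : g =o[𝓝 p] fun q => ‖q - p‖ ^ 3) : Dt (Dx (Dx g)) p = 0 := by
  have hg' : ∀ᶠ q in 𝓝 p, ContDiffAt ℝ 3 g q := hg.eventually (by simp)
  have hg2 : ∀ᶠ q in 𝓝 p, ContDiffAt ℝ 2 g q := hg'.mono fun q hq => hq.of_le (by norm_num)
  have hexp : ∀ a b : ℝ, dirDeriv (a, b) (dirDeriv (a, b) (dirDeriv (a, b) g)) p =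
      a ^ 3 * Dt (Dt (Dt g)) p + 3 * a ^ 2 * b * Dt (Dt (Dx g)) p +
      3 * a * b ^ 2 * Dt (Dx (Dx g)) p + b ^ 3 * Dx (Dx (Dx g)) p := by
    intro a b
    have hlin : ∀ k : ℝ × ℝ → ℝ, dirDeriv (a, b) k = fun q => a * Dt k q + b * Dx k q := by
      intro k
      ext q
      rw [Dt_eq, Dx_eq, ← dirDeriv_lin]
      simp
    have hlin2 : ∀ k : ℝ × ℝ → ℝ, ∀ q, ContDiffAt ℝ 2 k q → ∀ v : ℝ × ℝ,
        dirDeriv v (dirDeriv (a, b) k) q =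
          a * dirDeriv v (Dt k) q + b * dirDeriv v (Dx k) q := by
      intro k q hk v
      have h1 := (Dt_smooth (m := 1) hk (by norm_num)).differentiableAt (by simp)
      have h2 := (Dx_smooth (m := 1) hk (by norm_num)).differentiableAt (by simp)
      rw [hlin, dirDeriv_add (h1.const_mul a) (h2.const_mul b),
        dirDeriv_mul (differentiableAt_const _) h1, dirDeriv_mul (differentiableAt_const _) h2,
        dirDeriv_const, dirDeriv_const]
      ring
    have hsec : dirDeriv (a, b) (dirDeriv (a, b) g) =ᶠ[𝓝 p] fun q =>
        a * (a * Dt (Dt g) q) + b * (a * Dt (Dx g) q) +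
          b * (a * Dt (Dx g) q + b * Dx (Dx g) q) := by
      filter_upwards [hg2] with q hq
      rw [hlin2 g q hq]
      have hc : Dx (Dt g) q = Dt (Dx g) q := dirDeriv_comm hq _ _
      simp only [hlin, hc]
      ring
    have hDt : ContDiffAt ℝ 2 (Dt g) p := Dt_smooth hg (by norm_num)
    have hDx : ContDiffAt ℝ 2 (Dx g) p := Dx_smooth hg (by norm_num)
    have htt := (Dt_smooth (m := 1) hDt (by norm_num)).differentiableAt (by simp)
    have htx := (Dt_smooth (m := 1) hDx (by norm_num)).differentiableAt (by simp)
    have hxx := (Dx_smooth (m := 1) hDx (by norm_num)).differentiableAt (by simp)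
    have hthird : ∀ v : ℝ × ℝ, dirDeriv v (dirDeriv (a, b) (dirDeriv (a, b) g)) p =
        a ^ 2 * dirDeriv v (Dt (Dt g)) p + 2 * a * b * dirDeriv v (Dt (Dx g)) p +
          b ^ 2 * dirDeriv v (Dx (Dx g)) p := by
      intro v
      rw [(dirDeriv_congr hsec v).self_of_nhds]
      rw [show (fun q => a * (a * Dt (Dt g) q) + b * (a * Dt (Dx g) q) +
          b * (a * Dt (Dx g) q + b * Dx (Dx g) q)) = fun q =>
          (a ^ 2 * Dt (Dt g) q + 2 * a * b * Dt (Dx g) q) + b ^ 2 * Dx (Dx g) q by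
        ext q; ring]
      rw [dirDeriv_add (g₁ := fun q => a ^ 2 * Dt (Dt g) q + 2 * a * b * Dt (Dx g) q)
          ((htt.const_mul _).add (htx.const_mul _)) (hxx.const_mul _),
        dirDeriv_add (htt.const_mul _) (htx.const_mul _),
        dirDeriv_mul (differentiableAt_const _) htt, dirDeriv_mul (differentiableAt_const _) htx,
        dirDeriv_mul (differentiableAt_const _) hxx]
      simp only [dirDeriv_const]
      ring
    rw [hlin (dirDeriv (a, b) (dirDeriv (a, b) g))]
    have e1 : Dt (dirDeriv (a, b) (dirDeriv (a, b) g)) p = _ := hthird (1, 0)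
    have e2 : Dx (dirDeriv (a, b) (dirDeriv (a, b) g)) p = _ := hthird (0, 1)
    simp only [e1, e2]
    have c1 : dirDeriv (0, 1) (Dt (Dx g)) p = Dt (Dx (Dx g)) p := dirDeriv_comm hDx _ _
    have c2 : dirDeriv (0, 1) (Dt (Dt g)) p = Dt (Dt (Dx g)) p := by
      have : dirDeriv (0, 1) (Dt (Dt g)) p = Dt (Dx (Dt g)) p := dirDeriv_comm hDt _ _
      rw [this]
      refine (dirDeriv_congr (g₁ := Dx (Dt g)) (g₂ := Dt (Dx g)) ?_ _).self_of_nhds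
      filter_upwards [hg2] with q hq
      exact dirDeriv_comm hq _ _
    rw [c1, c2]
    simp only [Dt_eq, Dx_eq]
    ring
  have h := fun a b => (hexp a b).symm.trans (third_dirDeriv_eq_zero hg ho (a, b))
  have h1 := h 1 0
  have h2 := h 1 1
  have h3 := h 1 (-1)
  norm_num at h1 h2 h3
  linarith

/-! ### Polynomials realizing prescribed jets -/

/-- A polynomial in `(t, x)` with prescribed Taylor coefficients at `p`. -/
def jetPoly (p : ℝ × ℝ) (m a b c e k α β γ : ℝ) : ℝ × ℝ → ℝ := fun q =>
  m + a * (q.1 - p.1) + b * (q.2 - p.2) + c * (q.2 - p.2) ^ 2 + e * ((q.1 - p.1) * (q.2 - p.2)) +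
    k * ((q.1 - p.1) * (q.2 - p.2) ^ 2) + α * (q.1 - p.1) ^ 3 +
    β * ((q.1 - p.1) ^ 2 * (q.2 - p.2)) + γ * (q.2 - p.2) ^ 3

theorem jetPoly_smooth (p : ℝ × ℝ) (m a b c e k α β γ : ℝ) :
    ContDiff ℝ ∞ (jetPoly p m a b c e k α β γ) := by
  unfold jetPoly
  fun_prop

theorem dirDeriv_eq_deriv {u : ℝ × ℝ → ℝ} {q : ℝ × ℝ} (hu : DifferentiableAt ℝ u q)
    (v : ℝ × ℝ) {d : ℝ} (h : HasDerivAt (fun s : ℝ => u (q + s • v)) d 0) :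
    dirDeriv v u q = d := by
  have hl : HasDerivAt (fun s : ℝ => q + s • v) v 0 := by
    simpa using ((hasDerivAt_id (0 : ℝ)).smul_const v).const_add q
  have : HasFDerivAt u (fderiv ℝ u q) (q + (0 : ℝ) • v) := by simpa using hu.hasFDerivAt
  exact (this.comp_hasDerivAt 0 hl).unique h

theorem Dx_jetPoly (p : ℝ × ℝ) (m a b c e k α β γ : ℝ) :
    Dx (jetPoly p m a b c e k α β γ) =
      fun q => b + 2 * c * (q.2 - p.2) + e * (q.1 - p.1) + 2 * k * ((q.1 - p.1) * (q.2 - p.2)) +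
        β * (q.1 - p.1) ^ 2 + 3 * γ * (q.2 - p.2) ^ 2 := by
  ext q
  refine dirDeriv_eq_deriv ((jetPoly_smooth ..).differentiable (by simp) q) _ ?_
  have hy : HasDerivAt (fun s : ℝ => q.2 + s - p.2) 1 0 :=
    ((hasDerivAt_id (0 : ℝ)).const_add q.2).sub_const p.2
  have := (((((hy.const_mul b).add ((hy.pow 2).const_mul c)).add
    (hy.const_mul (e * (q.1 - p.1)))).add ((hy.pow 2).const_mul (k * (q.1 - p.1)))).add
    (hy.const_mul (β * (q.1 - p.1) ^ 2))).add ((hy.pow 3).const_mul γ)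
  refine ((this.const_add (m + a * (q.1 - p.1) + α * (q.1 - p.1) ^ 3)).congr_deriv
    ?_).congr_of_eventuallyEq (Eventually.of_forall fun s => ?_)
  · simp
    ring
  · simp [jetPoly]
    ring

theorem Dt_jetPoly (p : ℝ × ℝ) (m a b c e k α β γ : ℝ) :
    Dt (jetPoly p m a b c e k α β γ) =
      fun q => a + e * (q.2 - p.2) + k * (q.2 - p.2) ^ 2 + 3 * α * (q.1 - p.1) ^ 2 +
        2 * β * ((q.1 - p.1) * (q.2 - p.2)) := by
  ext q
  refine dirDeriv_eq_deriv ((jetPoly_smooth ..).differentiable (by simp) q) _ ?_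
  have hy : HasDerivAt (fun s : ℝ => q.1 + s - p.1) 1 0 :=
    ((hasDerivAt_id (0 : ℝ)).const_add q.1).sub_const p.1
  have := ((((hy.const_mul a).add (hy.const_mul (e * (q.2 - p.2)))).add
    (hy.const_mul (k * (q.2 - p.2) ^ 2))).add ((hy.pow 3).const_mul α)).add
    ((hy.pow 2).const_mul (β * (q.2 - p.2)))
  refine ((this.const_add (m + b * (q.2 - p.2) + c * (q.2 - p.2) ^ 2 + γ * (q.2 - p.2) ^ 3)).congr_deriv
    ?_).congr_of_eventuallyEq (Eventually.of_forall fun s => ?_)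
  · simp
    ring
  · simp [jetPoly]
    ring

theorem jetPoly_apply_self (p : ℝ × ℝ) (m a b c e k α β γ : ℝ) :
    jetPoly p m a b c e k α β γ p = m := by
  simp [jetPoly]

theorem Dt_jetPoly_self (p : ℝ × ℝ) (m a b c e k α β γ : ℝ) :
    Dt (jetPoly p m a b c e k α β γ) p = a := by
  simp [Dt_jetPoly]

theorem Dx_jetPoly_self (p : ℝ × ℝ) (m a b c e k α β γ : ℝ) :
    Dx (jetPoly p m a b c e k α β γ) p = b := by
  simp [Dx_jetPoly]

/-- The family `jetPoly` has no pure `t²` term, so the `β` term is split off. It contributes nothing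
afterwards: its `x`-derivative is zero, and its `t`-derivative vanishes at `p`. -/
theorem Dx_jetPoly_eq_jetPoly (p : ℝ × ℝ) (m a b c e k α β γ : ℝ) :
    Dx (jetPoly p m a b c e k α β γ) = fun q =>
      jetPoly p b e (2 * c) (3 * γ) (2 * k) 0 0 0 0 q + β * (q.1 - p.1) ^ 2 := by
  rw [Dx_jetPoly]
  ext q
  simp only [jetPoly]
  ring

theorem DxDx_jetPoly (p : ℝ × ℝ) (m a b c e k α β γ : ℝ) :
    Dx (Dx (jetPoly p m a b c e k α β γ)) =
      jetPoly p (2 * c) (2 * k) (6 * γ) 0 0 0 0 0 0 := by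
  ext q
  rw [Dx_jetPoly_eq_jetPoly, Dx_eq, dirDeriv_add
    ((jetPoly_smooth ..).differentiable (by simp) q) (by fun_prop), ← Dx_eq, Dx_jetPoly]
  have : dirDeriv (0, 1) (fun q : ℝ × ℝ => β * (q.1 - p.1) ^ 2) q = 0 := by
    refine dirDeriv_eq_deriv (by fun_prop) _ ?_
    simpa using hasDerivAt_const (0 : ℝ) (β * (q.1 - p.1) ^ 2)
  rw [this]
  simp only [jetPoly]
  ring

theorem DtDx_jetPoly_self (p : ℝ × ℝ) (m a b c e k α β γ : ℝ) :
    Dt (Dx (jetPoly p m a b c e k α β γ)) p = e := by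
  rw [Dx_jetPoly_eq_jetPoly, Dt_eq, dirDeriv_add
    ((jetPoly_smooth ..).differentiable (by simp) p) (by fun_prop), ← Dt_eq, Dt_jetPoly_self]
  have : dirDeriv (1, 0) (fun q : ℝ × ℝ => β * (q.1 - p.1) ^ 2) p = 0 := by
    refine dirDeriv_eq_deriv (by fun_prop) _ ?_
    simpa using ((hasDerivAt_id (0 : ℝ)).pow 2).const_mul β
  rw [this, add_zero]

theorem DxDx_jetPoly_self (p : ℝ × ℝ) (m a b c e k α β γ : ℝ) :
    Dx (Dx (jetPoly p m a b c e k α β γ)) p = 2 * c := by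
  rw [DxDx_jetPoly, jetPoly_apply_self]

theorem DtDxDx_jetPoly_self (p : ℝ × ℝ) (m a b c e k α β γ : ℝ) :
    Dt (Dx (Dx (jetPoly p m a b c e k α β γ))) p = 2 * k := by
  rw [DxDx_jetPoly, Dt_jetPoly_self]

/-! ### Graphs and their images under a point transformation -/

/-- The inverse function theorem. Nondegeneracy is taken as a trivial kernel, which suffices in
finite dimension and is the form in which the total Jacobian condition is checked. -/
theorem exists_smooth_localInverse {φ : ℝ × ℝ → ℝ × ℝ} {p : ℝ × ℝ} (hφ : ContDiffAt ℝ ∞ φ p)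
    (hinj : ∀ y, fderiv ℝ φ p y = 0 → y = 0) :
    ∃ (L : (ℝ × ℝ) ≃L[ℝ] ℝ × ℝ) (ψ : ℝ × ℝ → ℝ × ℝ),
      (∀ y, L y = fderiv ℝ φ p y) ∧ ContDiffAt ℝ ∞ ψ (φ p) ∧
      HasFDerivAt ψ (L.symm : ℝ × ℝ →L[ℝ] ℝ × ℝ) (φ p) ∧ ψ (φ p) = p ∧
      (∀ᶠ q in 𝓝 p, ψ (φ q) = q) ∧ ∀ᶠ y in 𝓝 (φ p), φ (ψ y) = y := by
  have hinj' : Function.Injective (fderiv ℝ φ p : ℝ × ℝ →ₗ[ℝ] ℝ × ℝ) :=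
    (injective_iff_map_eq_zero _).2 hinj
  let L : (ℝ × ℝ) ≃L[ℝ] ℝ × ℝ :=
    (LinearEquiv.ofInjectiveEndo _ hinj').toContinuousLinearEquiv
  have hL : ∀ y, L y = fderiv ℝ φ p y := fun y => rfl
  have hL' : (L : ℝ × ℝ →L[ℝ] ℝ × ℝ) = fderiv ℝ φ p := by ext <;> simp [hL]
  have hd : HasFDerivAt φ (L : ℝ × ℝ →L[ℝ] ℝ × ℝ) p := by
    rw [hL']
    exact (hφ.differentiableAt (by simp)).hasFDerivAt
  have hs := hφ.hasStrictFDerivAt' hd (by simp)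
  exact ⟨L, hφ.localInverse hd (by simp), hL, hφ.to_localInverse hd (by simp),
    hs.to_localInverse.hasFDerivAt, hφ.localInverse_apply_image hd (by simp),
    hs.eventually_left_inverse, hs.eventually_right_inverse⟩

/-- The map `(t, x) ↦ (t, x, u (t, x))`. -/
def graphMap (u : ℝ × ℝ → ℝ) (q : ℝ × ℝ) : ℝ × ℝ × ℝ := (q.1, q.2, u q)

theorem graphMap_smooth {n : WithTop ℕ∞} {u : ℝ × ℝ → ℝ} {p : ℝ × ℝ} (hu : ContDiffAt ℝ n u p) :
    ContDiffAt ℝ n (graphMap u) p :=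
  contDiffAt_fst.prodMk (contDiffAt_snd.prodMk hu)

theorem fderiv_graphMap {u : ℝ × ℝ → ℝ} {p : ℝ × ℝ} (hu : DifferentiableAt ℝ u p) (y : ℝ × ℝ) :
    fderiv ℝ (graphMap u) p y = (y.1, y.2, fderiv ℝ u p y) := by
  have : HasFDerivAt (graphMap u) _ p :=
    hasFDerivAt_fst.prodMk (hasFDerivAt_snd.prodMk hu.hasFDerivAt)
  rw [this.fderiv]
  rfl

theorem differentiableAt_graphMap {u : ℝ × ℝ → ℝ} {p : ℝ × ℝ} (hu : DifferentiableAt ℝ u p) :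
    DifferentiableAt ℝ (graphMap u) p :=
  differentiableAt_fst.prodMk (differentiableAt_snd.prodMk hu)

theorem fderiv_apply_pair (u : ℝ × ℝ → ℝ) (p y : ℝ × ℝ) :
    fderiv ℝ u p y = Dt u p * y.1 + Dx u p * y.2 := by
  have := dirDeriv_lin y.1 y.2 (1, 0) (0, 1) u p
  simp only [Prod.smul_mk, smul_eq_mul, mul_one, mul_zero, Prod.mk_add_mk, add_zero,
    zero_add] at this
  simp only [Dt_eq, Dx_eq]
  rw [mul_comm _ y.1, mul_comm _ y.2, ← this]
  rfl

/-- The `(t, x)`-components of a point transformation along the graph of `u`. -/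
def baseMap (Φ : ℝ × ℝ × ℝ → ℝ × ℝ × ℝ) (u : ℝ × ℝ → ℝ) (q : ℝ × ℝ) : ℝ × ℝ :=
  ((Φ (graphMap u q)).1, (Φ (graphMap u q)).2.1)

theorem baseMap_smooth {Φ : ℝ × ℝ × ℝ → ℝ × ℝ × ℝ} {u : ℝ × ℝ → ℝ} {p : ℝ × ℝ}
    (hΦ : ContDiffAt ℝ ∞ Φ (graphMap u p)) (hu : ContDiffAt ℝ ∞ u p) :
    ContDiffAt ℝ ∞ (baseMap Φ u) p := by
  have h : ContDiffAt ℝ ∞ (fun q => Φ (graphMap u q)) p := hΦ.comp p (graphMap_smooth hu)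
  exact h.fst.prodMk h.snd.fst

theorem fderiv_baseMap {Φ : ℝ × ℝ × ℝ → ℝ × ℝ × ℝ} {u : ℝ × ℝ → ℝ} {p : ℝ × ℝ}
    (hΦ : DifferentiableAt ℝ Φ (graphMap u p)) (hu : DifferentiableAt ℝ u p) (y : ℝ × ℝ) :
    fderiv ℝ (baseMap Φ u) p y =
      ((fderiv ℝ Φ (graphMap u p) (y.1, y.2, Dt u p * y.1 + Dx u p * y.2)).1,
        (fderiv ℝ Φ (graphMap u p) (y.1, y.2, Dt u p * y.1 + Dx u p * y.2)).2.1) := by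
  have h : HasFDerivAt (fun q => Φ (graphMap u q)) _ p :=
    hΦ.hasFDerivAt.comp p (differentiableAt_graphMap hu).hasFDerivAt
  have h2 : HasFDerivAt (baseMap Φ u) _ p := h.fst.prodMk h.snd.fst
  rw [h2.fderiv, ← fderiv_apply_pair, ← fderiv_graphMap hu]
  rfl

theorem isBigO_sub_fst (p : ℝ × ℝ) : (fun q : ℝ × ℝ => q.1 - p.1) =O[𝓝 p] fun q => ‖q - p‖ :=
  IsBigO.of_bound 1 (Eventually.of_forall fun q => by
    simpa using norm_fst_le (q - p))

theorem isBigO_sub_snd (p : ℝ × ℝ) : (fun q : ℝ × ℝ => q.2 - p.2) =O[𝓝 p] fun q => ‖q - p‖ :=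
  IsBigO.of_bound 1 (Eventually.of_forall fun q => by
    simpa using norm_snd_le (q - p))

/-! ### The effect of a cubic perturbation on the transformed function -/

/-- The binary cubic form without the coefficient at `τ ξ²`. -/
def cubicForm (α β γ : ℝ) (y : ℝ × ℝ) : ℝ := α * y.1 ^ 3 + β * (y.1 ^ 2 * y.2) + γ * y.2 ^ 3

theorem cubicForm_isBigO (α β γ : ℝ) (p : ℝ × ℝ) :
    (fun q => cubicForm α β γ (q - p)) =O[𝓝 p] fun q => ‖q - p‖ ^ 3 := by
  have h1 := isBigO_sub_fst p
  have h2 := isBigO_sub_snd p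
  refine ((((h1.pow 3).const_mul_left α).add (IsBigO.const_mul_left ?_ β)).add
    ((h2.pow 3).const_mul_left γ))
  refine ((h1.pow 2).mul h2).congr_right fun q => ?_
  ring

theorem isLittleO_mul_sub_mul {l : Filter (ℝ × ℝ)} {a a' b b' r s : ℝ × ℝ → ℝ}
    (ha : a =O[l] r) (hb' : b' =O[l] s)
    (h1 : (fun y => a y - a' y) =o[l] r) (h2 : (fun y => b y - b' y) =o[l] s) :
    (fun y => a y * b y - a' y * b' y) =o[l] fun y => r y * s y := by
  refine ((ha.mul_isLittleO h2).add (h1.mul_isBigO hb')).congr_left fun y => ?_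
  ring

/-- Differentiability of `ψ` is enough: each factor of a cubic monomial is `O(r)` and is replaced by
its linear part with error `o(r)`, so the product changes by `o(r³)`. -/
theorem cubicForm_comp_isLittleO {ψ : ℝ × ℝ → ℝ × ℝ} {N : ℝ × ℝ →L[ℝ] ℝ × ℝ} {y₀ : ℝ × ℝ}
    (hψ : HasFDerivAt ψ N y₀) (α β γ : ℝ) :
    (fun y => cubicForm α β γ (ψ y - ψ y₀) - cubicForm α β γ (N (y - y₀))) =o[𝓝 y₀]
      fun y => ‖y - y₀‖ ^ 3 := by
  have ho : (fun y => (ψ y - ψ y₀) - N (y - y₀)) =o[𝓝 y₀] fun y => ‖y - y₀‖ :=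
    hψ.isLittleO.norm_right
  have hO : (fun y => ψ y - ψ y₀) =O[𝓝 y₀] fun y => ‖y - y₀‖ := hψ.isBigO_sub.norm_right
  have hN : (fun y => N (y - y₀)) =O[𝓝 y₀] fun y => ‖y - y₀‖ :=
    (N.isBigO_comp _ _).norm_right
  have o1 : (fun y => (ψ y - ψ y₀).1 - (N (y - y₀)).1) =o[𝓝 y₀] fun y => ‖y - y₀‖ :=
    (IsBigO.of_bound 1 (Eventually.of_forall fun y => by
      simpa using norm_fst_le ((ψ y - ψ y₀) - N (y - y₀)))).trans_isLittleO ho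
  have o2 : (fun y => (ψ y - ψ y₀).2 - (N (y - y₀)).2) =o[𝓝 y₀] fun y => ‖y - y₀‖ :=
    (IsBigO.of_bound 1 (Eventually.of_forall fun y => by
      simpa using norm_snd_le ((ψ y - ψ y₀) - N (y - y₀)))).trans_isLittleO ho
  have O1 : (fun y => (ψ y - ψ y₀).1) =O[𝓝 y₀] fun y => ‖y - y₀‖ :=
    (IsBigO.of_bound 1 (Eventually.of_forall fun y => by
      simpa using norm_fst_le (ψ y - ψ y₀))).trans hO
  have O2 : (fun y => (ψ y - ψ y₀).2) =O[𝓝 y₀] fun y => ‖y - y₀‖ :=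
    (IsBigO.of_bound 1 (Eventually.of_forall fun y => by
      simpa using norm_snd_le (ψ y - ψ y₀))).trans hO
  have N1 : (fun y => (N (y - y₀)).1) =O[𝓝 y₀] fun y => ‖y - y₀‖ :=
    (IsBigO.of_bound 1 (Eventually.of_forall fun y => by
      simpa using norm_fst_le (N (y - y₀)))).trans hN
  have N2 : (fun y => (N (y - y₀)).2) =O[𝓝 y₀] fun y => ‖y - y₀‖ :=
    (IsBigO.of_bound 1 (Eventually.of_forall fun y => by
      simpa using norm_snd_le (N (y - y₀)))).trans hN
  have q11 := isLittleO_mul_sub_mul O1 N1 o1 o1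
  have q22 := isLittleO_mul_sub_mul O2 N2 o2 o2
  have c111 := isLittleO_mul_sub_mul (O1.mul O1) N1 q11 o1
  have c112 := isLittleO_mul_sub_mul (O1.mul O1) N2 q11 o2
  have c222 := isLittleO_mul_sub_mul (O2.mul O2) N2 q22 o2
  refine (((c111.const_mul_left α).add (c112.const_mul_left β)).add
    (c222.const_mul_left γ)).congr (fun y => ?_) fun y => ?_
  · simp only [cubicForm]
    ring
  · ring

/-- Strict differentiability is needed here: both points being compared move with `q`, and they
differ only in the `u`-direction, by `w q`. -/
theorem graph_perturbation_isLittleO {G : ℝ × ℝ × ℝ → ℝ} {u w : ℝ × ℝ → ℝ} {p : ℝ × ℝ}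
    (hG : ContDiffAt ℝ 1 G (graphMap u p)) (hu : ContinuousAt u p) (hw : ContinuousAt w p)
    (hw0 : w p = 0) :
    (fun q => G (graphMap (fun q => u q + w q) q) - G (graphMap u q) -
      dirDeriv (0, 0, 1) G (graphMap u p) * w q) =o[𝓝 p] w := by
  have hs := hG.hasStrictFDerivAt (by simp)
  have ht : Tendsto (fun q => (graphMap (fun q => u q + w q) q, graphMap u q)) (𝓝 p)
      (𝓝 (graphMap u p, graphMap u p)) := by
    have hc : ContinuousAt
        (fun q => (graphMap (fun q => u q + w q) q, graphMap u q)) p := by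
      unfold graphMap
      fun_prop
    have := hc.tendsto
    simpa [graphMap, hw0] using this
  have hdiff : ∀ q, graphMap (fun q => u q + w q) q - graphMap u q = w q • (0, 0, 1) := by
    intro q
    simp [graphMap]
  refine ((hs.isLittleO.comp_tendsto ht).congr_left fun q => ?_).trans_isBigO ?_
  · simp only [Function.comp, hdiff, map_smul, smul_eq_mul, dirDeriv]
    ring
  · refine IsBigO.of_bound 1 (Eventually.of_forall fun q => ?_)
    simp only [Function.comp, hdiff]
    simp [Prod.norm_def]

theorem Dt_congr {v₁ v₂ : ℝ × ℝ → ℝ} {p : ℝ × ℝ} (h : v₁ =ᶠ[𝓝 p] v₂) : Dt v₁ =ᶠ[𝓝 p] Dt v₂ :=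
  dirDeriv_congr h _

theorem Dx_congr {v₁ v₂ : ℝ × ℝ → ℝ} {p : ℝ × ℝ} (h : v₁ =ᶠ[𝓝 p] v₂) : Dx v₁ =ᶠ[𝓝 p] Dx v₂ :=
  dirDeriv_congr h _

theorem DtDxDx_sub {v₁ v₂ : ℝ × ℝ → ℝ} {p : ℝ × ℝ} (h₁ : ContDiffAt ℝ 3 v₁ p)
    (h₂ : ContDiffAt ℝ 3 v₂ p) :
    Dt (Dx (Dx fun q => v₁ q - v₂ q)) p = Dt (Dx (Dx v₁)) p - Dt (Dx (Dx v₂)) p := by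
  have e1 : Dx (fun q => v₁ q - v₂ q) =ᶠ[𝓝 p] fun q => Dx v₁ q - Dx v₂ q := by
    filter_upwards [h₁.eventually (by simp), h₂.eventually (by simp)] with q k₁ k₂
    exact dirDeriv_sub (k₁.differentiableAt (by simp)) (k₂.differentiableAt (by simp)) _
  have d₁ : ContDiffAt ℝ 2 (Dx v₁) p := Dx_smooth h₁ (by norm_num)
  have d₂ : ContDiffAt ℝ 2 (Dx v₂) p := Dx_smooth h₂ (by norm_num)
  have e2 : Dx (fun q => Dx v₁ q - Dx v₂ q) =ᶠ[𝓝 p] fun q => Dx (Dx v₁) q - Dx (Dx v₂) q := by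
    filter_upwards [d₁.eventually (by simp), d₂.eventually (by simp)] with q k₁ k₂
    exact dirDeriv_sub (k₁.differentiableAt (by simp)) (k₂.differentiableAt (by simp)) _
  rw [(Dt_congr ((Dx_congr e1).trans e2)).self_of_nhds]
  exact dirDeriv_sub ((Dx_smooth (m := 1) d₁ (by norm_num)).differentiableAt (by simp))
    ((Dx_smooth (m := 1) d₂ (by norm_num)).differentiableAt (by simp)) _

theorem jets_of_sub_isLittleO {v₁ v₂ : ℝ × ℝ → ℝ} {p : ℝ × ℝ} {k α β γ : ℝ}
    (h₁ : ContDiffAt ℝ 3 v₁ p) (h₂ : ContDiffAt ℝ 3 v₂ p)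
    (ho : (fun q => v₁ q - v₂ q - jetPoly p 0 0 0 0 0 k α β γ q) =o[𝓝 p] fun q => ‖q - p‖ ^ 3) :
    v₁ p = v₂ p ∧ Dt v₁ p = Dt v₂ p ∧ Dx v₁ p = Dx v₂ p ∧
      Dt (Dx (Dx v₁)) p = Dt (Dx (Dx v₂)) p + 2 * k := by
  have hJ : ContDiffAt ℝ 3 (jetPoly p 0 0 0 0 0 k α β γ) p :=
    (jetPoly_smooth ..).contDiffAt.of_le (by simpa using ENat.LEInfty.out)
  have hd : ContDiffAt ℝ 3 (fun q => v₁ q - v₂ q) p := h₁.sub h₂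
  obtain ⟨e0, e1⟩ := fderiv_eq_zero_of_isLittleO ho
  have e3 := DtDxDx_eq_zero_of_isLittleO (hd.sub hJ) ho
  rw [DtDxDx_sub hd hJ, DtDxDx_sub h₁ h₂, DtDxDx_jetPoly_self] at e3
  rw [jetPoly_apply_self] at e0
  have hfirst : ∀ v : ℝ × ℝ, dirDeriv v v₁ p - dirDeriv v v₂ p -
      dirDeriv v (jetPoly p 0 0 0 0 0 k α β γ) p = 0 := by
    intro v
    rw [← dirDeriv_sub (h₁.differentiableAt (by simp)) (h₂.differentiableAt (by simp)),
      ← dirDeriv_sub (hd.differentiableAt (by simp)) (hJ.differentiableAt (by simp)), dirDeriv, e1]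
    rfl
  have et : Dt v₁ p - Dt v₂ p - Dt (jetPoly p 0 0 0 0 0 k α β γ) p = 0 := hfirst (1, 0)
  have ex : Dx v₁ p - Dx v₂ p - Dx (jetPoly p 0 0 0 0 0 k α β γ) p = 0 := hfirst (0, 1)
  rw [Dt_jetPoly_self] at et
  rw [Dx_jetPoly_self] at ex
  exact ⟨by linarith, by linarith, by linarith, by linarith⟩

/-- When the total differential of `(T, X)` is injective, the image of the graph of `u` is locally a
graph again: `v` is the `u`-component along the graph, precomposed with the inverse of `baseMap Φ
u`. -/
theorem exists_transformed {Φ : ℝ × ℝ × ℝ → ℝ × ℝ × ℝ} {u : ℝ × ℝ → ℝ} {p : ℝ × ℝ}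
    (hΦ : ContDiffAt ℝ ∞ Φ (graphMap u p)) (hu : ContDiffAt ℝ ∞ u p)
    (hinj : ∀ y, fderiv ℝ (baseMap Φ u) p y = 0 → y = 0) :
    ∃ v : ℝ × ℝ → ℝ, ContDiffAt ℝ ∞ v (baseMap Φ u p) ∧ MapsGraphNear Φ u v p := by
  obtain ⟨L, ψ, -, hψ, -, hψp, hleft, -⟩ := exists_smooth_localInverse (baseMap_smooth hΦ hu) hinj
  refine ⟨fun y => (Φ (graphMap u (ψ y))).2.2, ?_, ?_⟩
  · have h : ContDiffAt ℝ ∞ (fun q => (Φ (graphMap u q)).2.2) p :=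
      (hΦ.comp p (graphMap_smooth hu)).snd.snd
    refine ContDiffAt.comp (baseMap Φ u p) (g := fun q => (Φ (graphMap u q)).2.2) ?_ hψ
    rwa [hψp]
  · filter_upwards [hleft] with q hq
    change (Φ (graphMap u (ψ (baseMap Φ u q)))).2.2 = (Φ (graphMap u q)).2.2
    rw [hq]

/-- The function whose zero set is the preimage of the graph of `v` under `Φ`. -/
def graphDefect (Φ : ℝ × ℝ × ℝ → ℝ × ℝ × ℝ) (v : ℝ × ℝ → ℝ) (z : ℝ × ℝ × ℝ) : ℝ :=
  (Φ z).2.2 - v ((Φ z).1, (Φ z).2.1)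

theorem graphDefect_smooth {Φ : ℝ × ℝ × ℝ → ℝ × ℝ × ℝ} {v : ℝ × ℝ → ℝ} {z : ℝ × ℝ × ℝ}
    (hΦ : ContDiffAt ℝ ∞ Φ z) (hv : ContDiffAt ℝ ∞ v ((Φ z).1, (Φ z).2.1)) :
    ContDiffAt ℝ ∞ (graphDefect Φ v) z :=
  hΦ.snd.snd.sub (hv.comp (g := v) z (hΦ.fst.prodMk hΦ.snd.fst))

/-- The defect vanishes along the graph of `u`, so its differential kills the tangent plane of the
graph. If it also killed the `u`-direction it would be zero, contradicting its value on a vector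
that `Φ` sends to `(0, 0, 1)`. This is the nonzero factor by which a small vertical perturbation of
`u` is transmitted to `v`. -/
theorem dirDeriv_graphDefect_ne_zero {Φ : ℝ × ℝ × ℝ → ℝ × ℝ × ℝ} {u v : ℝ × ℝ → ℝ} {p : ℝ × ℝ}
    (hΦ : ContDiffAt ℝ ∞ Φ (graphMap u p)) (hu : ContDiffAt ℝ ∞ u p)
    (hv : ContDiffAt ℝ ∞ v (baseMap Φ u p)) (hm : MapsGraphNear Φ u v p)
    (hsurj : Function.Surjective (fderiv ℝ Φ (graphMap u p))) :
    dirDeriv (0, 0, 1) (graphDefect Φ v) (graphMap u p) ≠ 0 := by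
  intro h0
  set z := graphMap u p
  have hG := (graphDefect_smooth hΦ hv).differentiableAt (by simp)
  have hzero : graphDefect Φ v ∘ graphMap u =ᶠ[𝓝 p] fun _ => 0 := by
    filter_upwards [hm] with q hq
    exact sub_eq_zero.2 hq.symm
  have hgr := differentiableAt_graphMap (hu.differentiableAt (by simp))
  have hcomp : fderiv ℝ (graphDefect Φ v ∘ graphMap u) p = 0 := by
    rw [hzero.fderiv_eq]
    simp
  rw [fderiv_comp p hG hgr] at hcomp
  have hall : ∀ y : ℝ × ℝ × ℝ, fderiv ℝ (graphDefect Φ v) z y = 0 := by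
    intro y
    have h1 := DFunLike.congr_fun hcomp (y.1, y.2.1)
    simp only [ContinuousLinearMap.comp_apply, zero_apply,
      fderiv_graphMap (hu.differentiableAt (by simp))] at h1
    have hy : y = (y.1, y.2.1, fderiv ℝ u p (y.1, y.2.1)) +
        (y.2.2 - fderiv ℝ u p (y.1, y.2.1)) • ((0, 0, 1) : ℝ × ℝ × ℝ) := by
      ext <;> simp
    have h2 : fderiv ℝ (graphDefect Φ v) z (0, 0, 1) = 0 := h0
    rw [hy, map_add, map_smul, h1, h2]
    simp
  -- On this vector the differential of `U - v(T, X)` equals `1`.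
  obtain ⟨y, hy⟩ := hsurj (0, 0, 1)
  have hΦ' := hΦ.differentiableAt (by simp)
  have hvd : HasFDerivAt v (fderiv ℝ v (baseMap Φ u p)) ((Φ z).1, (Φ z).2.1) :=
    (hv.differentiableAt (by simp)).hasFDerivAt
  have hder : HasFDerivAt (graphDefect Φ v) _ z :=
    hΦ'.hasFDerivAt.snd.snd.sub
      (hvd.comp z (hΦ'.hasFDerivAt.fst.prodMk hΦ'.hasFDerivAt.snd.fst))
  have h3 := hall y
  rw [hder.fderiv] at h3
  simp [hy, show ((0, 0) : ℝ × ℝ) = 0 from rfl] at h3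

/-- To third order, `vε - v` is `κ` times the cubic form composed with the inverse `N` of the total
differential. The columns of `N` are `(a₁, a₂)` and `(b₁, b₂)`, and the bracket in the last
conclusion is the `τ ξ²` coefficient of the composed cubic; the 1-jet is unaffected. -/
theorem transformed_cubic_perturbation {Φ : ℝ × ℝ × ℝ → ℝ × ℝ × ℝ} {u v vε : ℝ × ℝ → ℝ}
    {p : ℝ × ℝ} (α β γ : ℝ)
    (hΦ : ContDiffAt ℝ ∞ Φ (graphMap u p)) (hu : ContDiffAt ℝ ∞ u p)
    (hinj : ∀ y, fderiv ℝ (baseMap Φ u) p y = 0 → y = 0)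
    (hv : ContDiffAt ℝ ∞ v (baseMap Φ u p)) (hvε : ContDiffAt ℝ ∞ vε (baseMap Φ u p))
    (hm : MapsGraphNear Φ u v p)
    (hmε : MapsGraphNear Φ (fun q => u q + cubicForm α β γ (q - p)) vε p)
    {a₁ a₂ b₁ b₂ : ℝ} (ha : fderiv ℝ (baseMap Φ u) p (a₁, a₂) = (1, 0))
    (hb : fderiv ℝ (baseMap Φ u) p (b₁, b₂) = (0, 1)) :
    vε (baseMap Φ u p) = v (baseMap Φ u p) ∧
    Dt vε (baseMap Φ u p) = Dt v (baseMap Φ u p) ∧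
    Dx vε (baseMap Φ u p) = Dx v (baseMap Φ u p) ∧
    Dt (Dx (Dx vε)) (baseMap Φ u p) = Dt (Dx (Dx v)) (baseMap Φ u p) +
      2 * (dirDeriv (0, 0, 1) (graphDefect Φ v) (graphMap u p) *
        (3 * α * a₁ * b₁ ^ 2 + β * (2 * a₁ * b₁ * b₂ + b₁ ^ 2 * a₂) + 3 * γ * a₂ * b₂ ^ 2)) := by
  set w : ℝ × ℝ → ℝ := fun q => cubicForm α β γ (q - p) with hw
  set uε : ℝ × ℝ → ℝ := fun q => u q + w q with huε
  set κ := dirDeriv (0, 0, 1) (graphDefect Φ v) (graphMap u p) with hκ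
  have hwJ : w = jetPoly p 0 0 0 0 0 0 α β γ := by
    ext q
    simp [hw, cubicForm, jetPoly]
  have hwp : w p = 0 := by simp [hw, cubicForm]
  have hws : ContDiff ℝ ∞ w := by rw [hwJ]; exact jetPoly_smooth ..
  have huεs : ContDiffAt ℝ ∞ uε p := hu.add hws.contDiffAt
  have hgr : graphMap uε p = graphMap u p := by simp [graphMap, huε, hwp]
  have hbase : baseMap Φ uε p = baseMap Φ u p := by simp [baseMap, hgr]
  have hud := hu.differentiableAt (by simp)
  have hwd := hws.contDiffAt (x := p) |>.differentiableAt (by simp)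
  have hDt : Dt uε p = Dt u p := by
    have : Dt uε p = Dt u p + Dt w p := dirDeriv_add hud hwd _
    rw [this, hwJ, Dt_jetPoly_self, add_zero]
  have hDx : Dx uε p = Dx u p := by
    have : Dx uε p = Dx u p + Dx w p := dirDeriv_add hud hwd _
    rw [this, hwJ, Dx_jetPoly_self, add_zero]
  have hΦε : ContDiffAt ℝ ∞ Φ (graphMap uε p) := by rwa [hgr]
  have hder : ∀ y, fderiv ℝ (baseMap Φ uε) p y = fderiv ℝ (baseMap Φ u) p y := by
    intro y
    rw [fderiv_baseMap (hΦ.differentiableAt (by simp)) hud,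
      fderiv_baseMap (hΦε.differentiableAt (by simp)) (huεs.differentiableAt (by simp)),
      hDt, hDx, hgr]
  obtain ⟨L, ψ, hL, hψ, hψ', hψp, -, hright⟩ :=
    exists_smooth_localInverse (baseMap_smooth hΦε huεs) fun y hy => hinj y (by rw [← hder, hy])
  rw [hbase] at hψ hψ' hψp hright
  set p' := baseMap Φ u p
  have hNa : L.symm (1, 0) = (a₁, a₂) := by
    rw [← ha, ← hder, ← hL, L.symm_apply_apply]
  have hNb : L.symm (0, 1) = (b₁, b₂) := by
    rw [← hb, ← hder, ← hL, L.symm_apply_apply]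
  have hN : ∀ y : ℝ × ℝ, L.symm y = (y.1 * a₁ + y.2 * b₁, y.1 * a₂ + y.2 * b₂) := by
    intro y
    have hy : y = y.1 • ((1, 0) : ℝ × ℝ) + y.2 • ((0, 1) : ℝ × ℝ) := by ext <;> simp
    conv_lhs => rw [hy, map_add, map_smul, map_smul, hNa, hNb]
    simp
  have hwO : w =O[𝓝 p] fun q => ‖q - p‖ ^ 3 := cubicForm_isBigO α β γ p
  -- Over the base point of the perturbed graph, `vε` equals the `u`-component of `Φ`, so `vε - v`
  -- is the defect of `v` on the perturbed graph. On the original graph that defect is zero, and the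
  -- first-order expansion in the `u`-direction applies.
  have hpert : (fun q => (vε (baseMap Φ uε q) - v (baseMap Φ uε q)) - κ * w q) =o[𝓝 p]
      fun q => ‖q - p‖ ^ 3 := by
    have hG : ContDiffAt ℝ ∞ (graphDefect Φ v) (graphMap u p) := graphDefect_smooth hΦ hv
    have h := (graph_perturbation_isLittleO (hG.of_le (by simp))
      hu.continuousAt hws.continuous.continuousAt hwp).trans_isBigO hwO
    refine h.congr' ?_ EventuallyEq.rfl
    filter_upwards [hm, hmε] with q hq hqε
    have e1 : graphDefect Φ v (graphMap u q) = 0 := sub_eq_zero.2 hq.symm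
    have e2 : vε (baseMap Φ uε q) = (Φ (graphMap uε q)).2.2 := hqε
    rw [e1, e2]
    simp only [graphDefect, baseMap, sub_zero, huε, hκ]
  have hψt : Tendsto ψ (𝓝 p') (𝓝 p) := by
    have := hψ.continuousAt.tendsto
    rwa [hψp] at this
  have h1 : (fun y => (vε y - v y) - κ * cubicForm α β γ (ψ y - ψ p')) =o[𝓝 p']
      fun y => ‖y - p'‖ ^ 3 := by
    have hO : (fun y => ‖ψ y - p‖ ^ 3) =O[𝓝 p'] fun y => ‖y - p'‖ ^ 3 := by
      have := hψ'.isBigO_sub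
      rw [hψp] at this
      exact this.norm_norm.pow 3
    refine ((hpert.comp_tendsto hψt).trans_isBigO hO).congr' ?_ EventuallyEq.rfl
    filter_upwards [hright] with y hy
    simp only [Function.comp, hy, hψp, hw]
  have h2 := (cubicForm_comp_isLittleO hψ' α β γ).const_mul_left κ
  -- The last four coefficients are those of the transformed cubic at `τ ξ²`, `τ³`, `τ² ξ` and `ξ³`;
  -- only the first enters the target equation.
  have h3 : (fun y => vε y - v y - jetPoly p' 0 0 0 0 0
      (κ * (3 * α * a₁ * b₁ ^ 2 + β * (2 * a₁ * b₁ * b₂ + b₁ ^ 2 * a₂) + 3 * γ * a₂ * b₂ ^ 2))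
      (κ * (α * a₁ ^ 3 + β * (a₁ ^ 2 * a₂) + γ * a₂ ^ 3))
      (κ * (3 * α * a₁ ^ 2 * b₁ + β * (a₁ ^ 2 * b₂ + 2 * a₁ * b₁ * a₂) + 3 * γ * a₂ ^ 2 * b₂))
      (κ * (α * b₁ ^ 3 + β * (b₁ ^ 2 * b₂) + γ * b₂ ^ 3)) y) =o[𝓝 p']
      fun y => ‖y - p'‖ ^ 3 := by
    refine (h1.add h2).congr_left fun y => ?_
    simp only [ContinuousLinearEquiv.coe_coe, hN, cubicForm, jetPoly, Prod.fst_sub, Prod.snd_sub]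
    ring
  exact jets_of_sub_isLittleO (hvε.of_le (by simpa using ENat.LEInfty.out))
    (hv.of_le (by simpa using ENat.LEInfty.out)) h3

/-! ### `T` depends only on `t`, and `X` only on `x` -/

/-- For a `1`-jet at which the prolongation is defined, the total derivatives `D_x T` and `D_t X`
of the components of an admissible transformation vanish. -/
theorem cross_total_derivatives_eq_zero {E E' : Equation} {Ω : Set (ℝ × ℝ × ℝ)}
    {Φ : ℝ × ℝ × ℝ → ℝ × ℝ × ℝ} (hA : IsAdmissible E E' Ω Φ) {z : ℝ × ℝ × ℝ} (hz : z ∈ Ω)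
    (hsurj : Function.Surjective (fderiv ℝ Φ z)) (a b : ℝ)
    (hinj : ∀ y : ℝ × ℝ, (fderiv ℝ Φ z (y.1, y.2, a * y.1 + b * y.2)).1 = 0 →
      (fderiv ℝ Φ z (y.1, y.2, a * y.1 + b * y.2)).2.1 = 0 → y = 0) :
    (fderiv ℝ Φ z (0, 1, b)).1 = 0 ∧ (fderiv ℝ Φ z (1, 0, a)).2.1 = 0 := by
  set p : ℝ × ℝ := (z.1, z.2.1) with hp
  have hh := E.h_ne_zero _ (hA.source z hz)
  have hh' := E'.h_ne_zero _ (hA.target z hz)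
  -- Chosen so that `u_txx = 2k` solves the source equation at `p` for the given 1-jet.
  set k := -(a + (E.f z.1 + z.2.2) * b) / (2 * E.h z.1) with hk
  set u := jetPoly p z.2.2 a b 0 0 k 0 0 0 with hu
  have hus : ∀ q, ContDiffAt ℝ ∞ u q := fun q => (jetPoly_smooth ..).contDiffAt
  have hgr : graphMap u p = z := by simp [graphMap, hu, jetPoly_apply_self, hp]
  have hΦ : ContDiffAt ℝ ∞ Φ (graphMap u p) := by
    rw [hgr]
    exact hA.point.smooth.contDiffAt (hA.isOpen.mem_nhds hz)
  have hDt : Dt u p = a := Dt_jetPoly_self ..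
  have hDx : Dx u p = b := Dx_jetPoly_self ..
  have hfd : ∀ y, fderiv ℝ (baseMap Φ u) p y =
      ((fderiv ℝ Φ z (y.1, y.2, a * y.1 + b * y.2)).1,
        (fderiv ℝ Φ z (y.1, y.2, a * y.1 + b * y.2)).2.1) := by
    intro y
    rw [fderiv_baseMap (hΦ.differentiableAt (by simp)) ((hus p).differentiableAt (by simp)),
      hDt, hDx, hgr]
  have hinj' : ∀ y, fderiv ℝ (baseMap Φ u) p y = 0 → y = 0 := by
    intro y hy
    rw [hfd, Prod.mk_eq_zero] at hy
    exact hinj y hy.1 hy.2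
  obtain ⟨v, hv, hm⟩ := exists_transformed hΦ (hus p) hinj'
  obtain ⟨L, -, hL, -⟩ := exists_smooth_localInverse (baseMap_smooth hΦ (hus p)) hinj'
  obtain ⟨⟨a₁, a₂⟩, ha⟩ := L.surjective (1, 0)
  obtain ⟨⟨b₁, b₂⟩, hb⟩ := L.surjective (0, 1)
  rw [hL] at ha hb
  have hκ := dirDeriv_graphDefect_ne_zero hΦ (hus p) hv hm (by rwa [hgr])
  have hzΩ : ∀ {u' : ℝ × ℝ → ℝ}, graphMap u' p = z → (p.1, p.2, u' p) ∈ Ω := by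
    intro u' h
    change graphMap u' p ∈ Ω
    rwa [h]
  have hE : E.HoldsAt u p := by
    rw [Equation.HoldsAt, hDt, hDx, hu, DtDxDx_jetPoly_self, jetPoly_apply_self, hk]
    field_simp
    ring
  have hE' := (hA.maps u v p _ (hzΩ hgr) rfl (hus p) hv hm).1 hE
  -- The cubic perturbation leaves `u`, `u_t`, `u_x` and `u_txx` at `p` unchanged, so the source
  -- equation persists. Both transformed functions then satisfy the target equation at the same
  -- point, and subtracting leaves `2 h' κ` times this coefficient, with `h' κ ≠ 0`.
  have main : ∀ α β γ : ℝ,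
      3 * α * a₁ * b₁ ^ 2 + β * (2 * a₁ * b₁ * b₂ + b₁ ^ 2 * a₂) + 3 * γ * a₂ * b₂ ^ 2 = 0 := by
    intro α β γ
    have huε : (fun q => u q + cubicForm α β γ (q - p)) = jetPoly p z.2.2 a b 0 0 k α β γ := by
      ext q
      simp [hu, cubicForm, jetPoly]
      ring
    have hgrε : graphMap (jetPoly p z.2.2 a b 0 0 k α β γ) p = z := by
      simp [graphMap, jetPoly_apply_self, hp]
    have hbε : baseMap Φ (jetPoly p z.2.2 a b 0 0 k α β γ) p = baseMap Φ u p := by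
      simp [baseMap, hgr, hgrε]
    have hΦε : ContDiffAt ℝ ∞ Φ (graphMap (jetPoly p z.2.2 a b 0 0 k α β γ) p) := by
      rwa [hgrε, ← hgr]
    obtain ⟨vε, hvε, hmε⟩ := exists_transformed hΦε (jetPoly_smooth ..).contDiffAt (fun y hy => by
      rw [fderiv_baseMap (hΦε.differentiableAt (by simp))
        ((jetPoly_smooth ..).differentiable (by simp) p), Dt_jetPoly_self, Dx_jetPoly_self,
        hgrε, Prod.mk_eq_zero] at hy
      exact hinj y hy.1 hy.2)
    have hEε : E.HoldsAt (jetPoly p z.2.2 a b 0 0 k α β γ) p := by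
      rw [Equation.HoldsAt] at hE ⊢
      rw [Dt_jetPoly_self, Dx_jetPoly_self, DtDxDx_jetPoly_self, jetPoly_apply_self]
      rwa [hDt, hDx, hu, DtDxDx_jetPoly_self, jetPoly_apply_self] at hE
    have hEε' := (hA.maps _ vε p _ (hzΩ hgrε) rfl (jetPoly_smooth ..).contDiffAt hvε hmε).1 hEε
    have hEε'' : E'.HoldsAt vε (baseMap Φ u p) := by
      rw [← hbε]
      exact hEε'
    rw [hbε] at hvε
    obtain ⟨e0, e1, e2, e3⟩ := transformed_cubic_perturbation α β γ hΦ (hus p) hinj' hv hvε hm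
      (by rw [huε]; exact hmε) ha hb
    have hE'' : E'.HoldsAt v (baseMap Φ u p) := hE'
    rw [Equation.HoldsAt] at hEε'' hE''
    rw [e0, e1, e2, e3] at hEε''
    have hhb : E'.h (baseMap Φ u p).1 ≠ 0 := by
      simpa [baseMap, hgr] using hh'
    have : E'.h (baseMap Φ u p).1 * dirDeriv (0, 0, 1) (graphDefect Φ v) (graphMap u p) *
      (3 * α * a₁ * b₁ ^ 2 + β * (2 * a₁ * b₁ * b₂ + b₁ ^ 2 * a₂) + 3 * γ * a₂ * b₂ ^ 2) = 0 := by
      linarith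
    exact (mul_eq_zero.1 this).resolve_left (mul_ne_zero hhb hκ)
  -- These say `a₁ b₁² = 0`, `2 a₁ b₁ b₂ + a₂ b₁² = 0` and `a₂ b₂² = 0`. Since the columns are
  -- independent, they force `b₁ = a₂ = 0`: the inverse differential is diagonal, hence so is the
  -- differential.
  have m1 := main 1 0 0
  have m2 := main 0 1 0
  have m3 := main 0 0 1
  have hlin : ∀ y₁ y₂ : ℝ, fderiv ℝ (baseMap Φ u) p (y₁, y₂) =
      y₁ • fderiv ℝ (baseMap Φ u) p (1, 0) + y₂ • fderiv ℝ (baseMap Φ u) p (0, 1) := by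
    intro y₁ y₂
    rw [← map_smul, ← map_smul, ← map_add]
    simp
  have e10 := hfd (1, 0)
  have e01 := hfd (0, 1)
  simp only [mul_one, mul_zero, add_zero, zero_add] at e10 e01
  rw [hlin, e10, e01] at ha hb
  simp only [Prod.smul_mk, smul_eq_mul, Prod.mk_add_mk, Prod.mk.injEq] at ha hb
  obtain ⟨ha1, ha2⟩ := ha
  obtain ⟨hb1, hb2⟩ := hb
  set A := (fderiv ℝ Φ z (1, 0, a)).1
  set B := (fderiv ℝ Φ z (0, 1, b)).1
  set C := (fderiv ℝ Φ z (1, 0, a)).2.1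
  set D := (fderiv ℝ Φ z (0, 1, b)).2.1
  have hdet : (A * D - B * C) * (a₁ * b₂ - a₂ * b₁) = 1 := by
    linear_combination (b₁ * C + b₂ * D) * ha1 - (b₁ * A + b₂ * B) * ha2 + hb2
  have hb10 : b₁ = 0 := by
    by_contra hne
    have ha₁ : a₁ = 0 := by
      have : a₁ * b₁ ^ 2 = 0 := by linarith
      exact (mul_eq_zero.1 this).resolve_right (pow_ne_zero 2 hne)
    have ha₂ : a₂ = 0 := by
      have : a₂ * b₁ ^ 2 = 0 := by rw [ha₁] at m2; linarith
      exact (mul_eq_zero.1 this).resolve_right (pow_ne_zero 2 hne)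
    rw [ha₁, ha₂] at hdet
    simp at hdet
  have hb20 : b₂ ≠ 0 := by
    intro h
    rw [h, hb10] at hdet
    simp at hdet
  have ha20 : a₂ = 0 := by
    have : a₂ * b₂ ^ 2 = 0 := by linarith
    exact (mul_eq_zero.1 this).resolve_right (pow_ne_zero 2 hb20)
  have ha10 : a₁ ≠ 0 := by
    intro h
    rw [h, ha20] at hdet
    simp at hdet
  constructor
  · have : b₂ * B = 0 := by rw [hb10] at hb1; linarith
    exact (mul_eq_zero.1 this).resolve_left hb20
  · have : a₁ * C = 0 := by rw [ha20] at ha2; linarith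
    exact (mul_eq_zero.1 this).resolve_left ha10

theorem surjective_of_det_ne_zero {M : ℝ × ℝ × ℝ →L[ℝ] ℝ × ℝ × ℝ} (h : M.det ≠ 0) :
    Function.Surjective M :=
  (LinearMap.equivOfDetNeZero (M : ℝ × ℝ × ℝ →ₗ[ℝ] ℝ × ℝ × ℝ) h).surjective

/-- The total Jacobian of `(T, X)` is an affine function of `(a, b) = (u_t, u_x)` whose coefficients
are 2×2 minors of the differential of `(T, X)`, not all zero. Wherever it is nonzero, `T_x + b T_u =
0` and `X_t + a X_u = 0`. If `T_u` were nonzero, the first equation would fail for all but one `b`,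
so the affine function would vanish at enough points to be zero; likewise for `X_u` with `a`. -/
theorem partials_eq_zero {E E' : Equation} {Ω : Set (ℝ × ℝ × ℝ)}
    {Φ : ℝ × ℝ × ℝ → ℝ × ℝ × ℝ} (hA : IsAdmissible E E' Ω Φ) {z : ℝ × ℝ × ℝ} (hz : z ∈ Ω) :
    (fderiv ℝ Φ z (0, 1, 0)).1 = 0 ∧ (fderiv ℝ Φ z (0, 0, 1)).1 = 0 ∧
    (fderiv ℝ Φ z (1, 0, 0)).2.1 = 0 ∧ (fderiv ℝ Φ z (0, 0, 1)).2.1 = 0 := by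
  have hsurj := surjective_of_det_ne_zero (hA.point.jacobian_ne_zero z hz)
  have hlin : ∀ y : ℝ × ℝ × ℝ, fderiv ℝ Φ z y = y.1 • fderiv ℝ Φ z (1, 0, 0) +
      y.2.1 • fderiv ℝ Φ z (0, 1, 0) + y.2.2 • fderiv ℝ Φ z (0, 0, 1) := by
    intro y
    rw [← map_smul, ← map_smul, ← map_smul, ← map_add, ← map_add]
    simp
  have hcross := cross_total_derivatives_eq_zero hA hz hsurj
  obtain ⟨y, hy⟩ := hsurj (1, 0, 0)
  obtain ⟨y', hy'⟩ := hsurj (0, 1, 0)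
  rw [hlin] at hy hy'
  rcases h1 : fderiv ℝ Φ z (1, 0, 0) with ⟨T₁, X₁, U₁⟩
  rcases h2 : fderiv ℝ Φ z (0, 1, 0) with ⟨T₂, X₂, U₂⟩
  rcases h3 : fderiv ℝ Φ z (0, 0, 1) with ⟨T₃, X₃, U₃⟩
  simp only [h1, h2, h3, Prod.smul_mk, smul_eq_mul, Prod.mk_add_mk, Prod.mk.injEq] at hy hy' hlin ⊢
  obtain ⟨hy1, hy2, -⟩ := hy
  obtain ⟨hy1', hy2', -⟩ := hy'
  -- Preimages of `(1, 0, 0)` and `(0, 1, 0)` exist, so `(dT, dX)` has rank two; the certificate is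
  -- the Cauchy–Binet formula for this pair.
  have hminor : ¬ (T₁ * X₂ - T₂ * X₁ = 0 ∧ T₃ * X₂ - T₂ * X₃ = 0 ∧ T₁ * X₃ - T₃ * X₁ = 0) := by
    rintro ⟨m1, m2, m3⟩
    have : (0 : ℝ) = 1 := by
      linear_combination (-(y.1 * y'.2.1 - y.2.1 * y'.1)) * m1
        + (y.2.1 * y'.2.2 - y.2.2 * y'.2.1) * m2 - (y.1 * y'.2.2 - y.2.2 * y'.1) * m3
        + (X₁ * y'.1 + X₂ * y'.2.1 + X₃ * y'.2.2) * hy1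
        - (T₁ * y'.1 + T₂ * y'.2.1 + T₃ * y'.2.2) * hy2 + hy2'
    exact zero_ne_one this
  have hgood : ∀ a b : ℝ, T₁ * X₂ - T₂ * X₁ + a * (T₃ * X₂ - T₂ * X₃) +
      b * (T₁ * X₃ - T₃ * X₁) ≠ 0 → T₂ + b * T₃ = 0 ∧ X₁ + a * X₃ = 0 := by
    intro a b hne
    have := hcross a b (by
      intro y e1 e2
      rw [hlin] at e1 e2
      simp only at e1 e2
      have k1 : y.1 * (T₁ * X₂ - T₂ * X₁ + a * (T₃ * X₂ - T₂ * X₃) +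
          b * (T₁ * X₃ - T₃ * X₁)) = 0 := by
        linear_combination (X₂ + b * X₃) * e1 - (T₂ + b * T₃) * e2
      have k2 : y.2 * (T₁ * X₂ - T₂ * X₁ + a * (T₃ * X₂ - T₂ * X₃) +
          b * (T₁ * X₃ - T₃ * X₁)) = 0 := by
        linear_combination (T₁ + a * T₃) * e2 - (X₁ + a * X₃) * e1
      ext
      · exact (mul_eq_zero.1 k1).resolve_right hne
      · exact (mul_eq_zero.1 k2).resolve_right hne)
    rw [hlin, hlin] at this
    simpa using this
  have hT₃ : T₃ = 0 := by
    by_contra hne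
    have hbad : ∀ a b : ℝ, T₂ + b * T₃ ≠ 0 → T₁ * X₂ - T₂ * X₁ + a * (T₃ * X₂ - T₂ * X₃) +
        b * (T₁ * X₃ - T₃ * X₁) = 0 := fun a b h => by
      by_contra h'
      exact h (hgood a b h').1
    have hb1 : T₂ + (-T₂ / T₃ + 1) * T₃ ≠ 0 := by field_simp; simpa using hne
    have hb2 : T₂ + (-T₂ / T₃ + 2) * T₃ ≠ 0 := by field_simp; simpa using hne
    -- Three non-collinear points `(a, b)` determine an affine function.
    have q1 := hbad 0 _ hb1
    have q2 := hbad 1 _ hb1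
    have q3 := hbad 0 _ hb2
    have m3 : T₁ * X₃ - T₃ * X₁ = 0 := by linarith
    rw [m3] at q1 q2
    exact hminor ⟨by linarith, by linarith, m3⟩
  have hX₃ : X₃ = 0 := by
    by_contra hne
    have hbad : ∀ a b : ℝ, X₁ + a * X₃ ≠ 0 → T₁ * X₂ - T₂ * X₁ + a * (T₃ * X₂ - T₂ * X₃) +
        b * (T₁ * X₃ - T₃ * X₁) = 0 := fun a b h => by
      by_contra h'
      exact h (hgood a b h').2
    have hb1 : X₁ + (-X₁ / X₃ + 1) * X₃ ≠ 0 := by field_simp; simpa using hne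
    have hb2 : X₁ + (-X₁ / X₃ + 2) * X₃ ≠ 0 := by field_simp; simpa using hne
    have q1 := hbad _ 0 hb1
    have q2 := hbad _ 1 hb1
    have q3 := hbad _ 0 hb2
    have m2 : T₃ * X₂ - T₂ * X₃ = 0 := by linarith
    rw [m2] at q1 q2
    exact hminor ⟨by linarith, m2, by linarith⟩
  subst hT₃ hX₃
  have := hgood 0 0 (fun h => hminor ⟨by linarith, by simp, by simp⟩)
  exact ⟨by linarith [this.1], rfl, by linarith [this.2], rfl⟩

/-! ### Chain rules for the prolongation -/

/-- The function `g` is differentiable at `z`, with derivative `d` in the direction `v`. -/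
def HasDirDeriv {E : Type*} [NormedAddCommGroup E] [NormedSpace ℝ E] (v : E) (g : E → ℝ) (z : E)
    (d : ℝ) : Prop := DifferentiableAt ℝ g z ∧ dirDeriv v g z = d

namespace HasDirDeriv

variable {E : Type*} [NormedAddCommGroup E] [NormedSpace ℝ E] {v z : E} {g₁ g₂ : E → ℝ} {d₁ d₂ : ℝ}

theorem add (h₁ : HasDirDeriv v g₁ z d₁) (h₂ : HasDirDeriv v g₂ z d₂) :
    HasDirDeriv v (fun y => g₁ y + g₂ y) z (d₁ + d₂) :=
  ⟨h₁.1.add h₂.1, by rw [dirDeriv_add h₁.1 h₂.1, h₁.2, h₂.2]⟩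

theorem mul (h₁ : HasDirDeriv v g₁ z d₁) (h₂ : HasDirDeriv v g₂ z d₂) :
    HasDirDeriv v (fun y => g₁ y * g₂ y) z (d₁ * g₂ z + g₁ z * d₂) :=
  ⟨h₁.1.mul h₂.1, by rw [dirDeriv_mul h₁.1 h₂.1, h₁.2, h₂.2]⟩

theorem const_mul (c : ℝ) (h₁ : HasDirDeriv v g₁ z d₁) :
    HasDirDeriv v (fun y => c * g₁ y) z (c * d₁) :=
  ⟨h₁.1.const_mul c, by
    rw [dirDeriv_mul (differentiableAt_const c) h₁.1, dirDeriv_const, h₁.2]; ring⟩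

end HasDirDeriv

theorem dirDeriv_comp_pair {k φ₁ φ₂ : ℝ × ℝ → ℝ} {q : ℝ × ℝ}
    (hk : DifferentiableAt ℝ k (φ₁ q, φ₂ q)) (h₁ : DifferentiableAt ℝ φ₁ q)
    (h₂ : DifferentiableAt ℝ φ₂ q) (e : ℝ × ℝ) :
    dirDeriv e (fun q => k (φ₁ q, φ₂ q)) q =
      Dt k (φ₁ q, φ₂ q) * dirDeriv e φ₁ q + Dx k (φ₁ q, φ₂ q) * dirDeriv e φ₂ q := by
  have h : HasFDerivAt (fun q => k (φ₁ q, φ₂ q)) _ q :=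
    hk.hasFDerivAt.comp q (h₁.hasFDerivAt.prodMk h₂.hasFDerivAt)
  simp only [dirDeriv]
  rw [h.fderiv]
  exact fderiv_apply_pair k _ _

/-- Derivatives of `v (φ₁, φ₂)`, where `φ₁` is a function of `t` and `φ₂` is a function of `x`. -/
theorem derivs_comp_separated {g v φ₁ φ₂ : ℝ × ℝ → ℝ} {p : ℝ × ℝ}
    (h₁ : ContDiffAt ℝ 3 φ₁ p) (h₂ : ContDiffAt ℝ 3 φ₂ p)
    (hv : ContDiffAt ℝ 3 v (φ₁ p, φ₂ p))
    (hx : Dx φ₁ =ᶠ[𝓝 p] fun _ => 0) (ht : Dt φ₂ =ᶠ[𝓝 p] fun _ => 0)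
    (hg : g =ᶠ[𝓝 p] fun q => v (φ₁ q, φ₂ q)) :
    Dt g p = Dt v (φ₁ p, φ₂ p) * Dt φ₁ p ∧
    Dx g p = Dx v (φ₁ p, φ₂ p) * Dx φ₂ p ∧
    Dt (Dx g) p = Dt (Dx v) (φ₁ p, φ₂ p) * Dt φ₁ p * Dx φ₂ p ∧
    Dt (Dx (Dx g)) p = Dt (Dx (Dx v)) (φ₁ p, φ₂ p) * Dt φ₁ p * Dx φ₂ p ^ 2 +
      Dt (Dx v) (φ₁ p, φ₂ p) * Dt φ₁ p * Dx (Dx φ₂) p := by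
  have hc : ContinuousAt (fun q => (φ₁ q, φ₂ q)) p := h₁.continuousAt.prodMk h₂.continuousAt
  have d₁ : ∀ᶠ q in 𝓝 p, DifferentiableAt ℝ φ₁ q :=
    (h₁.eventually (by simp)).mono fun q h => h.differentiableAt (by simp)
  have d₂ : ∀ᶠ q in 𝓝 p, DifferentiableAt ℝ φ₂ q :=
    (h₂.eventually (by simp)).mono fun q h => h.differentiableAt (by simp)
  have hdk : ∀ {k : ℝ × ℝ → ℝ}, ContDiffAt ℝ 1 k (φ₁ p, φ₂ p) →
      ∀ᶠ q in 𝓝 p, DifferentiableAt ℝ k (φ₁ q, φ₂ q) := fun hk =>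
    hc.tendsto.eventually ((hk.eventually (by simp)).mono fun q h => h.differentiableAt (by simp))
  have cx : ∀ {k : ℝ × ℝ → ℝ}, ContDiffAt ℝ 1 k (φ₁ p, φ₂ p) →
      Dx (fun q => k (φ₁ q, φ₂ q)) =ᶠ[𝓝 p] fun q => Dx k (φ₁ q, φ₂ q) * Dx φ₂ q := by
    intro k hk
    filter_upwards [d₁, d₂, hdk hk, hx] with q q₁ q₂ q₃ q₄
    have : Dx (fun q => k (φ₁ q, φ₂ q)) q =
        Dt k (φ₁ q, φ₂ q) * Dx φ₁ q + Dx k (φ₁ q, φ₂ q) * Dx φ₂ q :=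
      dirDeriv_comp_pair q₃ q₁ q₂ _
    rw [this, q₄]
    ring
  have ct : ∀ {k : ℝ × ℝ → ℝ}, ContDiffAt ℝ 1 k (φ₁ p, φ₂ p) →
      Dt (fun q => k (φ₁ q, φ₂ q)) =ᶠ[𝓝 p] fun q => Dt k (φ₁ q, φ₂ q) * Dt φ₁ q := by
    intro k hk
    filter_upwards [d₁, d₂, hdk hk, ht] with q q₁ q₂ q₃ q₄
    have : Dt (fun q => k (φ₁ q, φ₂ q)) q =
        Dt k (φ₁ q, φ₂ q) * Dt φ₁ q + Dx k (φ₁ q, φ₂ q) * Dt φ₂ q :=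
      dirDeriv_comp_pair q₃ q₁ q₂ _
    rw [this, q₄]
    ring
  have r2 : ContDiffAt ℝ 2 (Dx φ₂) p := Dx_smooth h₂ (by norm_num)
  have rx1 : ContDiffAt ℝ 1 (Dx (Dx φ₂)) p := Dx_smooth r2 (by norm_num)
  have v1 : ContDiffAt ℝ 2 (Dx v) (φ₁ p, φ₂ p) := Dx_smooth hv (by norm_num)
  have v2 : ContDiffAt ℝ 1 (Dx (Dx v)) (φ₁ p, φ₂ p) := Dx_smooth v1 (by norm_num)
  have v1' : ContDiffAt ℝ 1 (Dx v) (φ₁ p, φ₂ p) := v1.of_le (by norm_num)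
  have hrt : Dt (Dx φ₂) =ᶠ[𝓝 p] fun _ => 0 := by
    have h0 : Dx (Dt φ₂) =ᶠ[𝓝 p] fun _ => 0 :=
      (Dx_congr ht).trans (Eventually.of_forall fun q => dirDeriv_const _ _ _)
    filter_upwards [h₂.eventually (by simp), h0] with q hq hq0
    rw [← hq0]
    exact dirDeriv_comm (hq.of_le (by norm_num)) _ _
  have hrxt : Dt (Dx (Dx φ₂)) p = 0 := by
    have h0 : Dx (Dt (Dx φ₂)) p = 0 :=
      ((Dx_congr hrt).trans (Eventually.of_forall fun q => dirDeriv_const _ _ _)).self_of_nhds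
    rw [← h0]
    exact dirDeriv_comm r2 _ _
  have comp1 : ∀ {k : ℝ × ℝ → ℝ}, ContDiffAt ℝ 1 k (φ₁ p, φ₂ p) →
      ContDiffAt ℝ 1 (fun q => k (φ₁ q, φ₂ q)) p := fun hk =>
    hk.comp p ((h₁.of_le (by norm_num)).prodMk (h₂.of_le (by norm_num)))
  have ex := (Dx_congr hg).trans (cx (hv.of_le (by norm_num)))
  have exx : Dx (Dx g) =ᶠ[𝓝 p] fun q =>
      Dx (Dx v) (φ₁ q, φ₂ q) * Dx φ₂ q * Dx φ₂ q + Dx v (φ₁ q, φ₂ q) * Dx (Dx φ₂) q := by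
    refine (Dx_congr ex).trans ?_
    filter_upwards [(comp1 v1').eventually (by simp), r2.eventually (by simp), cx v1']
      with q q₁ q₂ q₃
    rw [← q₃]
    exact dirDeriv_mul (q₁.differentiableAt (by simp)) (q₂.differentiableAt (by simp)) _
  have dr := r2.differentiableAt (by simp)
  have drx := rx1.differentiableAt (by simp)
  have dv1 := (comp1 v1').differentiableAt (by simp)
  have dv2 := (comp1 v2).differentiableAt (by simp)
  refine ⟨?_, ex.self_of_nhds, ?_, ?_⟩
  · exact ((Dt_congr hg).trans (ct (hv.of_le (by norm_num)))).self_of_nhds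
  · rw [(Dt_congr ex).self_of_nhds]
    have e := dirDeriv_mul dv1 dr (1, 0)
    have e1 := (ct v1').self_of_nhds
    have e2 := hrt.self_of_nhds
    rw [Dt_eq] at e1 e2 ⊢
    rw [e, e1, e2]
    ring
  · rw [(Dt_congr exx).self_of_nhds]
    have e1 : HasDirDeriv (1, 0) _ p _ := ⟨dv1, (ct v1').self_of_nhds⟩
    have e2 : HasDirDeriv (1, 0) _ p _ := ⟨dv2, (ct v2).self_of_nhds⟩
    have e3 : HasDirDeriv (1, 0) _ p _ := ⟨dr, hrt.self_of_nhds⟩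
    have e4 : HasDirDeriv (1, 0) _ p _ := ⟨drx, hrxt⟩
    refine (((e2.mul e3).mul e3).add (e1.mul e4)).2.trans ?_
    ring

/-- The partial derivative with respect to `t` of a function of `(t, x, u)`. -/
def Pt (F : ℝ × ℝ × ℝ → ℝ) : ℝ × ℝ × ℝ → ℝ := dirDeriv (1, 0, 0) F

/-- The partial derivative with respect to `x` of a function of `(t, x, u)`. -/
def Px (F : ℝ × ℝ × ℝ → ℝ) : ℝ × ℝ × ℝ → ℝ := dirDeriv (0, 1, 0) F

/-- The partial derivative with respect to `u` of a function of `(t, x, u)`. -/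
def Pu (F : ℝ × ℝ × ℝ → ℝ) : ℝ × ℝ × ℝ → ℝ := dirDeriv (0, 0, 1) F

theorem fderiv_apply_triple (F : ℝ × ℝ × ℝ → ℝ) (z y : ℝ × ℝ × ℝ) :
    fderiv ℝ F z y = Pt F z * y.1 + Px F z * y.2.1 + Pu F z * y.2.2 := by
  have hy : y = y.1 • ((1, 0, 0) : ℝ × ℝ × ℝ) + y.2.1 • ((0, 1, 0) : ℝ × ℝ × ℝ) +
      y.2.2 • ((0, 0, 1) : ℝ × ℝ × ℝ) := by ext <;> simp
  conv_lhs => rw [hy, map_add, map_add, map_smul, map_smul, map_smul]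
  simp only [Pt, Px, Pu, dirDeriv, smul_eq_mul]
  ring

theorem dirDeriv_comp_graphMap {F : ℝ × ℝ × ℝ → ℝ} {u : ℝ × ℝ → ℝ} {q : ℝ × ℝ}
    (hF : DifferentiableAt ℝ F (graphMap u q)) (hu : DifferentiableAt ℝ u q) (e : ℝ × ℝ) :
    dirDeriv e (fun q => F (graphMap u q)) q =
      Pt F (graphMap u q) * e.1 + Px F (graphMap u q) * e.2 +
        Pu F (graphMap u q) * dirDeriv e u q := by
  have h : HasFDerivAt (fun q => F (graphMap u q)) _ q :=
    hF.hasFDerivAt.comp q (differentiableAt_graphMap hu).hasFDerivAt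
  have h2 := fderiv_graphMap hu e
  simp only [dirDeriv]
  rw [h.fderiv, ContinuousLinearMap.comp_apply, h2, fderiv_apply_triple]

theorem Dt_comp_graphMap {F : ℝ × ℝ × ℝ → ℝ} {u : ℝ × ℝ → ℝ} {q : ℝ × ℝ}
    (hF : DifferentiableAt ℝ F (graphMap u q)) (hu : DifferentiableAt ℝ u q) :
    Dt (fun q => F (graphMap u q)) q = Pt F (graphMap u q) + Pu F (graphMap u q) * Dt u q := by
  refine (dirDeriv_comp_graphMap hF hu (1, 0)).trans ?_
  rw [mul_one, mul_zero, add_zero]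
  rfl

theorem Dx_comp_graphMap {F : ℝ × ℝ × ℝ → ℝ} {u : ℝ × ℝ → ℝ} {q : ℝ × ℝ}
    (hF : DifferentiableAt ℝ F (graphMap u q)) (hu : DifferentiableAt ℝ u q) :
    Dx (fun q => F (graphMap u q)) q = Px F (graphMap u q) + Pu F (graphMap u q) * Dx u q := by
  refine (dirDeriv_comp_graphMap hF hu (0, 1)).trans ?_
  rw [mul_one, mul_zero, zero_add]
  rfl

theorem Px_smooth {m n : WithTop ℕ∞} {F : ℝ × ℝ × ℝ → ℝ} {z : ℝ × ℝ × ℝ} (hF : ContDiffAt ℝ n F z)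
    (h : m + 1 ≤ n) : ContDiffAt ℝ m (Px F) z := dirDeriv_smooth hF h _

theorem Pu_smooth {m n : WithTop ℕ∞} {F : ℝ × ℝ × ℝ → ℝ} {z : ℝ × ℝ × ℝ} (hF : ContDiffAt ℝ n F z)
    (h : m + 1 ≤ n) : ContDiffAt ℝ m (Pu F) z := dirDeriv_smooth hF h _

/-- The total derivatives of a function of `(t, x, u)` along the graph of `u`. -/
theorem total_derivs {U : ℝ × ℝ × ℝ → ℝ} {u : ℝ × ℝ → ℝ} {p : ℝ × ℝ}
    (hU : ContDiffAt ℝ 3 U (graphMap u p)) (hu : ContDiffAt ℝ 3 u p) :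
    Dt (Dx fun q => U (graphMap u q)) p =
      Pt (Px U) (graphMap u p) + Pu (Px U) (graphMap u p) * Dt u p +
      (Pt (Pu U) (graphMap u p) + Pu (Pu U) (graphMap u p) * Dt u p) * Dx u p +
      Pu U (graphMap u p) * Dt (Dx u) p ∧
    Dt (Dx (Dx fun q => U (graphMap u q))) p =
      Pt (Px (Px U)) (graphMap u p) + Pu (Px (Px U)) (graphMap u p) * Dt u p +
      2 * (Pt (Pu (Px U)) (graphMap u p) + Pu (Pu (Px U)) (graphMap u p) * Dt u p) * Dx u p +
      2 * Pu (Px U) (graphMap u p) * Dt (Dx u) p +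
      (Pt (Pu (Pu U)) (graphMap u p) + Pu (Pu (Pu U)) (graphMap u p) * Dt u p) * Dx u p ^ 2 +
      2 * Pu (Pu U) (graphMap u p) * Dx u p * Dt (Dx u) p +
      (Pt (Pu U) (graphMap u p) + Pu (Pu U) (graphMap u p) * Dt u p) * Dx (Dx u) p +
      Pu U (graphMap u p) * Dt (Dx (Dx u)) p := by
  have hγ : ContinuousAt (graphMap u) p := (graphMap_smooth hu).continuousAt
  have hγ1 : ContDiffAt ℝ 1 (graphMap u) p := graphMap_smooth (hu.of_le (by norm_num))
  have ev : ∀ {F : ℝ × ℝ × ℝ → ℝ}, ContDiffAt ℝ 1 F (graphMap u p) →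
      ∀ᶠ q in 𝓝 p, DifferentiableAt ℝ F (graphMap u q) := fun hF =>
    hγ.tendsto.eventually ((hF.eventually (by simp)).mono fun q h => h.differentiableAt (by simp))
  have evc : ∀ {F : ℝ × ℝ × ℝ → ℝ}, ContDiffAt ℝ 1 F (graphMap u p) →
      ∀ᶠ q in 𝓝 p, DifferentiableAt ℝ (fun q => F (graphMap u q)) q := fun hF =>
    ((ContDiffAt.comp p hF hγ1).eventually (by simp)).mono fun q h => h.differentiableAt (by simp)
  have evu : ∀ {k : ℝ × ℝ → ℝ}, ContDiffAt ℝ 1 k p → ∀ᶠ q in 𝓝 p, DifferentiableAt ℝ k q :=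
    fun hk => (hk.eventually (by simp)).mono fun q h => h.differentiableAt (by simp)
  have u1 : ContDiffAt ℝ 1 u p := hu.of_le (by norm_num)
  have ux : ContDiffAt ℝ 2 (Dx u) p := Dx_smooth hu (by norm_num)
  have ux1 : ContDiffAt ℝ 1 (Dx u) p := ux.of_le (by norm_num)
  have uxx1 : ContDiffAt ℝ 1 (Dx (Dx u)) p := Dx_smooth ux (by norm_num)
  have U1 : ContDiffAt ℝ 1 U (graphMap u p) := hU.of_le (by norm_num)
  have Ux : ContDiffAt ℝ 2 (Px U) (graphMap u p) := Px_smooth hU (by norm_num)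
  have Uu : ContDiffAt ℝ 2 (Pu U) (graphMap u p) := Pu_smooth hU (by norm_num)
  have Ux1 : ContDiffAt ℝ 1 (Px U) (graphMap u p) := Ux.of_le (by norm_num)
  have Uu1 : ContDiffAt ℝ 1 (Pu U) (graphMap u p) := Uu.of_le (by norm_num)
  have Uxx1 : ContDiffAt ℝ 1 (Px (Px U)) (graphMap u p) := Px_smooth Ux (by norm_num)
  have Uxu1 : ContDiffAt ℝ 1 (Pu (Px U)) (graphMap u p) := Pu_smooth Ux (by norm_num)
  have Uuu1 : ContDiffAt ℝ 1 (Pu (Pu U)) (graphMap u p) := Pu_smooth Uu (by norm_num)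
  have ex : Dx (fun q => U (graphMap u q)) =ᶠ[𝓝 p] fun q =>
      Px U (graphMap u q) + Pu U (graphMap u q) * Dx u q := by
    filter_upwards [ev U1, evu u1] with q q₁ q₂
    exact Dx_comp_graphMap q₁ q₂
  have hcomm : ∀ᶠ q in 𝓝 p, Px (Pu U) (graphMap u q) = Pu (Px U) (graphMap u q) := by
    have : ∀ᶠ z in 𝓝 (graphMap u p), Px (Pu U) z = Pu (Px U) z :=
      (hU.eventually (by simp)).mono fun z hz => dirDeriv_comm (hz.of_le (by norm_num)) _ _
    exact hγ.tendsto.eventually this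
  have exx : Dx (Dx fun q => U (graphMap u q)) =ᶠ[𝓝 p] fun q =>
      Px (Px U) (graphMap u q) + 2 * (Pu (Px U) (graphMap u q) * Dx u q) +
      Pu (Pu U) (graphMap u q) * (Dx u q * Dx u q) + Pu U (graphMap u q) * Dx (Dx u) q := by
    refine (Dx_congr ex).trans ?_
    filter_upwards [ev Ux1, ev Uu1, evc Ux1, evc Uu1, evu u1, evu ux1, hcomm]
      with q q₁ q₂ q₃ q₄ q₅ q₆ q₇
    have e3 : HasDirDeriv (0, 1) _ q _ := ⟨q₃, Dx_comp_graphMap q₁ q₅⟩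
    have e4 : HasDirDeriv (0, 1) _ q _ := ⟨q₄, Dx_comp_graphMap q₂ q₅⟩
    have e5 : HasDirDeriv (0, 1) (Dx u) q (Dx (Dx u) q) := ⟨q₆, rfl⟩
    refine (e3.add (e4.mul e5)).2.trans ?_
    rw [q₇]
    ring
  have dt : ∀ {F : ℝ × ℝ × ℝ → ℝ}, ContDiffAt ℝ 1 F (graphMap u p) →
      HasDirDeriv (1, 0) (fun q => F (graphMap u q)) p
        (Pt F (graphMap u p) + Pu F (graphMap u p) * Dt u p) := fun hF =>
    ⟨(evc hF).self_of_nhds,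
      Dt_comp_graphMap (hF.differentiableAt (by simp)) (u1.differentiableAt (by simp))⟩
  have k1 : HasDirDeriv (1, 0) (Dx u) p (Dt (Dx u) p) := ⟨ux1.differentiableAt (by simp), rfl⟩
  have k2 : HasDirDeriv (1, 0) (Dx (Dx u)) p (Dt (Dx (Dx u)) p) :=
    ⟨uxx1.differentiableAt (by simp), rfl⟩
  constructor
  · rw [(Dt_congr ex).self_of_nhds]
    refine ((dt Ux1).add ((dt Uu1).mul k1)).2.trans ?_
    ring
  · rw [(Dt_congr exx).self_of_nhds]
    refine ((((dt Uxx1).add (((dt Uxu1).mul k1).const_mul 2)).add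
      ((dt Uuu1).mul (k1.mul k1))).add ((dt Uu1).mul k2)).2.trans ?_
    ring

/-! ### The determining equation -/

/-- The `t`-component of `Φ`. -/
def compT (Φ : ℝ × ℝ × ℝ → ℝ × ℝ × ℝ) (z : ℝ × ℝ × ℝ) : ℝ := (Φ z).1

/-- The `x`-component of `Φ`. -/
def compX (Φ : ℝ × ℝ × ℝ → ℝ × ℝ × ℝ) (z : ℝ × ℝ × ℝ) : ℝ := (Φ z).2.1

/-- The `u`-component of `Φ`. -/
def compU (Φ : ℝ × ℝ × ℝ → ℝ × ℝ × ℝ) (z : ℝ × ℝ × ℝ) : ℝ := (Φ z).2.2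

theorem dirDeriv_compT {Φ : ℝ × ℝ × ℝ → ℝ × ℝ × ℝ} {z : ℝ × ℝ × ℝ} (h : DifferentiableAt ℝ Φ z)
    (v : ℝ × ℝ × ℝ) : dirDeriv v (compT Φ) z = (fderiv ℝ Φ z v).1 := by
  have : HasFDerivAt (compT Φ) _ z := h.hasFDerivAt.fst
  rw [dirDeriv, this.fderiv]
  rfl

theorem dirDeriv_compX {Φ : ℝ × ℝ × ℝ → ℝ × ℝ × ℝ} {z : ℝ × ℝ × ℝ} (h : DifferentiableAt ℝ Φ z)
    (v : ℝ × ℝ × ℝ) : dirDeriv v (compX Φ) z = (fderiv ℝ Φ z v).2.1 := by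
  have : HasFDerivAt (compX Φ) _ z := h.hasFDerivAt.snd.fst
  rw [dirDeriv, this.fderiv]
  rfl

theorem dirDeriv_compU {Φ : ℝ × ℝ × ℝ → ℝ × ℝ × ℝ} {z : ℝ × ℝ × ℝ} (h : DifferentiableAt ℝ Φ z)
    (v : ℝ × ℝ × ℝ) : dirDeriv v (compU Φ) z = (fderiv ℝ Φ z v).2.2 := by
  have : HasFDerivAt (compU Φ) _ z := h.hasFDerivAt.snd.snd
  rw [dirDeriv, this.fderiv]
  rfl

namespace IsAdmissible

variable {E E' : Equation} {Ω : Set (ℝ × ℝ × ℝ)} {Φ : ℝ × ℝ × ℝ → ℝ × ℝ × ℝ}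

theorem smoothAt (hA : IsAdmissible E E' Ω Φ) {z : ℝ × ℝ × ℝ} (hz : z ∈ Ω) :
    ContDiffAt ℝ ∞ Φ z := hA.point.smooth.contDiffAt (hA.isOpen.mem_nhds hz)

theorem partials (hA : IsAdmissible E E' Ω Φ) {z : ℝ × ℝ × ℝ} (hz : z ∈ Ω) :
    Px (compT Φ) z = 0 ∧ Pu (compT Φ) z = 0 ∧ Pt (compX Φ) z = 0 ∧ Pu (compX Φ) z = 0 := by
  have hd := (hA.smoothAt hz).differentiableAt (by simp)
  have := partials_eq_zero hA hz
  simpa only [Px, Pu, Pt, dirDeriv_compT hd, dirDeriv_compX hd] using this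

/-- Once the cross partials of `T` and `X` vanish, the differential of `Φ` is triangular with
diagonal `T_t`, `X_x`, `U_u`. -/
theorem partials_ne_zero (hA : IsAdmissible E E' Ω Φ) {z : ℝ × ℝ × ℝ} (hz : z ∈ Ω) :
    Pt (compT Φ) z ≠ 0 ∧ Px (compX Φ) z ≠ 0 ∧ Pu (compU Φ) z ≠ 0 := by
  have hd := (hA.smoothAt hz).differentiableAt (by simp)
  have hsurj := surjective_of_det_ne_zero (hA.point.jacobian_ne_zero z hz)
  obtain ⟨e1, e2, e3, e4⟩ := hA.partials hz
  have hT : ∀ y, (fderiv ℝ Φ z y).1 = Pt (compT Φ) z * y.1 := fun y => by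
    rw [← dirDeriv_compT hd, dirDeriv, fderiv_apply_triple, e1, e2]; ring
  have hX : ∀ y, (fderiv ℝ Φ z y).2.1 = Px (compX Φ) z * y.2.1 := fun y => by
    rw [← dirDeriv_compX hd, dirDeriv, fderiv_apply_triple, e3, e4]; ring
  have hU : ∀ y, (fderiv ℝ Φ z y).2.2 = Pt (compU Φ) z * y.1 + Px (compU Φ) z * y.2.1 +
      Pu (compU Φ) z * y.2.2 := fun y => by
    rw [← dirDeriv_compU hd, dirDeriv, fderiv_apply_triple]
  have h1 : Pt (compT Φ) z ≠ 0 := by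
    intro h
    obtain ⟨y, hy⟩ := hsurj (1, 0, 0)
    have := hT y
    rw [hy, h] at this
    simp at this
  have h2 : Px (compX Φ) z ≠ 0 := by
    intro h
    obtain ⟨y, hy⟩ := hsurj (0, 1, 0)
    have := hX y
    rw [hy, h] at this
    simp at this
  refine ⟨h1, h2, fun h => ?_⟩
  obtain ⟨y, hy⟩ := hsurj (0, 0, 1)
  have k1 := hT y
  have k2 := hX y
  have k3 := hU y
  rw [hy] at k1 k2 k3
  have y1 : y.1 = 0 := (mul_eq_zero.1 k1.symm).resolve_left h1
  have y2 : y.2.1 = 0 := (mul_eq_zero.1 k2.symm).resolve_left h2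
  rw [h, y1, y2] at k3
  simp at k3

/-- The determining equation, as an identity in the jet variables `a = u_t`, `b = u_x`, `c = u_xx`,
`e = u_tx`, `k = u_txx` on the manifold defined by the first equation. -/
theorem determining (hA : IsAdmissible E E' Ω Φ) {z : ℝ × ℝ × ℝ} (hz : z ∈ Ω) (a b c e k : ℝ)
    (hk : a + (E.f z.1 + z.2.2) * b + E.h z.1 * k = 0) :
    Px (compX Φ) z ^ 3 * (Pt (compU Φ) z + Pu (compU Φ) z * a) +
    (E'.f (Φ z).1 + (Φ z).2.2) * Pt (compT Φ) z * Px (compX Φ) z ^ 2 *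
      (Px (compU Φ) z + Pu (compU Φ) z * b) +
    E'.h (Φ z).1 * (Px (compX Φ) z *
      (Pt (Px (Px (compU Φ))) z + Pu (Px (Px (compU Φ))) z * a +
        2 * (Pt (Pu (Px (compU Φ))) z + Pu (Pu (Px (compU Φ))) z * a) * b +
        2 * Pu (Px (compU Φ)) z * e +
        (Pt (Pu (Pu (compU Φ))) z + Pu (Pu (Pu (compU Φ))) z * a) * b ^ 2 +
        2 * Pu (Pu (compU Φ)) z * b * e +
        (Pt (Pu (compU Φ)) z + Pu (Pu (compU Φ)) z * a) * c + Pu (compU Φ) z * k) -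
      Px (Px (compX Φ)) z *
      (Pt (Px (compU Φ)) z + Pu (Px (compU Φ)) z * a +
        (Pt (Pu (compU Φ)) z + Pu (Pu (compU Φ)) z * a) * b + Pu (compU Φ) z * e)) = 0 := by
  set p : ℝ × ℝ := (z.1, z.2.1) with hp
  -- The halves compensate for `u_xx` and `u_txx` being twice the corresponding Taylor coefficients.
  set u := jetPoly p z.2.2 a b (c / 2) e (k / 2) 0 0 0 with hu
  have hus : ContDiffAt ℝ ∞ u p := (jetPoly_smooth ..).contDiffAt
  have hud : ∀ q, DifferentiableAt ℝ u q := (jetPoly_smooth ..).differentiable (by simp)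
  have hgr : graphMap u p = z := by simp [graphMap, hu, jetPoly_apply_self, hp]
  have hΦ : ContDiffAt ℝ ∞ Φ (graphMap u p) := by rw [hgr]; exact hA.smoothAt hz
  have u0 : u p = z.2.2 := jetPoly_apply_self ..
  have ut : Dt u p = a := Dt_jetPoly_self ..
  have ux : Dx u p = b := Dx_jetPoly_self ..
  have uxx : Dx (Dx u) p = c := by rw [hu, DxDx_jetPoly_self]; ring
  have utx : Dt (Dx u) p = e := DtDx_jetPoly_self ..
  have utxx : Dt (Dx (Dx u)) p = k := by rw [hu, DtDxDx_jetPoly_self]; ring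
  obtain ⟨p0, r0, U0⟩ := hA.partials_ne_zero hz
  have hinj : ∀ y, fderiv ℝ (baseMap Φ u) p y = 0 → y = 0 := by
    intro y hy
    rw [fderiv_baseMap (hΦ.differentiableAt (by simp)) (hud p), hgr, Prod.mk_eq_zero] at hy
    have hd := (hA.smoothAt hz).differentiableAt (by simp)
    obtain ⟨e1, e2, e3, e4⟩ := hA.partials hz
    rw [← dirDeriv_compT hd, ← dirDeriv_compX hd, dirDeriv, dirDeriv, fderiv_apply_triple,
      fderiv_apply_triple, e1, e2, e3, e4] at hy
    simp only [zero_mul, add_zero, zero_add, mul_eq_zero] at hy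
    ext
    · exact hy.1.resolve_left p0
    · exact hy.2.resolve_left r0
  obtain ⟨v, hv, hm⟩ := exists_transformed hΦ hus hinj
  have hzΩ : (p.1, p.2, u p) ∈ Ω := by
    change graphMap u p ∈ Ω
    rwa [hgr]
  have hE : E.HoldsAt u p := by
    rw [Equation.HoldsAt, ut, ux, utxx, u0]
    linarith
  have hE' : E'.HoldsAt v (baseMap Φ u p) := (hA.maps u v p _ hzΩ rfl hus hv hm).1 hE
  have near : ∀ᶠ q in 𝓝 p, graphMap u q ∈ Ω := by
    have hc : ContinuousAt (graphMap u) p := (graphMap_smooth hus).continuousAt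
    exact hc.eventually (hA.isOpen.mem_nhds (by rwa [hgr]))
  have sT : ∀ {y}, y ∈ Ω → ContDiffAt ℝ ∞ (compT Φ) y := fun hy => (hA.smoothAt hy).fst
  have sX : ∀ {y}, y ∈ Ω → ContDiffAt ℝ ∞ (compX Φ) y := fun hy => (hA.smoothAt hy).snd.fst
  have sU : ∀ {y}, y ∈ Ω → ContDiffAt ℝ ∞ (compU Φ) y := fun hy => (hA.smoothAt hy).snd.snd
  have three : (3 : WithTop ℕ∞) ≤ ∞ := by simpa using ENat.LEInfty.out
  have hp_mem : graphMap u p ∈ Ω := hzΩ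
  set φ₁ : ℝ × ℝ → ℝ := fun q => compT Φ (graphMap u q) with hφ₁
  set φ₂ : ℝ × ℝ → ℝ := fun q => compX Φ (graphMap u q) with hφ₂
  have h₁ : ContDiffAt ℝ 3 φ₁ p := ((sT hp_mem).comp p (graphMap_smooth hus)).of_le three
  have h₂ : ContDiffAt ℝ 3 φ₂ p := ((sX hp_mem).comp p (graphMap_smooth hus)).of_le three
  have hx1 : Dx φ₁ =ᶠ[𝓝 p] fun _ => 0 := by
    filter_upwards [near] with q hq
    rw [hφ₁, Dx_comp_graphMap ((sT hq).differentiableAt (by simp)) (hud q), (hA.partials hq).1,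
      (hA.partials hq).2.1]
    ring
  have ht2 : Dt φ₂ =ᶠ[𝓝 p] fun _ => 0 := by
    filter_upwards [near] with q hq
    rw [hφ₂, Dt_comp_graphMap ((sX hq).differentiableAt (by simp)) (hud q),
      (hA.partials hq).2.2.1, (hA.partials hq).2.2.2]
    ring
  have ht1 : Dt φ₁ p = Pt (compT Φ) z := by
    rw [hφ₁, Dt_comp_graphMap ((sT hp_mem).differentiableAt (by simp)) (hud p),
      (hA.partials hp_mem).2.1, hgr]
    ring
  have hx2 : Dx φ₂ =ᶠ[𝓝 p] fun q => Px (compX Φ) (graphMap u q) := by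
    filter_upwards [near] with q hq
    rw [hφ₂, Dx_comp_graphMap ((sX hq).differentiableAt (by simp)) (hud q),
      (hA.partials hq).2.2.2]
    ring
  have hxx2 : Dx (Dx φ₂) p = Px (Px (compX Φ)) z := by
    have hd : ContDiffAt ℝ ∞ (Px (compX Φ)) (graphMap u p) := Px_smooth (sX hp_mem) (by simp)
    have h0 : Pu (Px (compX Φ)) z = 0 := by
      have hc : Pu (Px (compX Φ)) z = Px (Pu (compX Φ)) z :=
        dirDeriv_comm ((sX hz).of_le (by simpa using ENat.LEInfty.out)) _ _
      rw [hc]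
      have : Pu (compX Φ) =ᶠ[𝓝 z] fun _ => 0 := by
        filter_upwards [hA.isOpen.mem_nhds hz] with y hy
        exact (hA.partials hy).2.2.2
      exact ((dirDeriv_congr this _).trans
        (Eventually.of_forall fun q => dirDeriv_const _ _ _)).self_of_nhds
    rw [(Dx_congr hx2).self_of_nhds, Dx_comp_graphMap (hd.differentiableAt (by simp)) (hud p), hgr,
      h0]
    ring
  have hx2' : Dx φ₂ p = Px (compX Φ) z := by
    rw [← hgr]
    exact hx2.self_of_nhds
  have hbase : baseMap Φ u p = (φ₁ p, φ₂ p) := rfl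
  have hg : (fun q => compU Φ (graphMap u q)) =ᶠ[𝓝 p] fun q => v (φ₁ q, φ₂ q) := by
    filter_upwards [hm] with q hq
    exact hq.symm
  obtain ⟨g1, g2, g3, g4⟩ := derivs_comp_separated h₁ h₂ (hv.of_le three) hx1 ht2 hg
  obtain ⟨k3, k4⟩ := total_derivs ((sU hp_mem).of_le three) (hus.of_le three)
  have k1 := Dt_comp_graphMap ((sU hp_mem).differentiableAt (by simp)) (hud p)
  have k2 := Dx_comp_graphMap ((sU hp_mem).differentiableAt (by simp)) (hud p)
  have hv0 : v (φ₁ p, φ₂ p) = (Φ z).2.2 := by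
    have : v (φ₁ p, φ₂ p) = compU Φ (graphMap u p) := hg.self_of_nhds.symm
    rw [this, hgr]
    rfl
  have hφ1p : φ₁ p = (Φ z).1 := by
    change compT Φ (graphMap u p) = _
    rw [hgr]
    rfl
  rw [Equation.HoldsAt, hbase, hv0] at hE'
  simp only [hφ1p] at hE'
  rw [hφ1p] at g1 g2 g3 g4
  rw [k1] at g1
  rw [k2] at g2
  rw [k3] at g3
  rw [k4] at g4
  rw [hgr] at g1 g2 g3 g4
  rw [ht1] at g1 g3 g4
  rw [hx2'] at g2 g3 g4
  rw [hxx2] at g4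
  rw [ut, ux, uxx, utx, utxx] at g4
  rw [ut, ux, utx] at g3
  rw [ut] at g1
  rw [ux] at g2
  rw [g1, g2, g3, g4]
  -- The determining equation is the target equation multiplied by `T_t X_x³`, which clears the
  -- chain-rule denominators. Its `X_xx` term cancels the `v_tx` contribution contained in the
  -- third-order total derivative of `U`.
  linear_combination Pt (compT Φ) z * Px (compX Φ) z ^ 3 * hE'

end IsAdmissible

/-! ### Functions with constant partial derivatives on a domain -/

section Open

variable {Ω : Set (ℝ × ℝ × ℝ)} {F : ℝ × ℝ × ℝ → ℝ}

theorem dirDeriv_eq_zero_of_eqOn_const (hΩ : IsOpen Ω) {c : ℝ} (h : ∀ y ∈ Ω, F y = c)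
    (v : ℝ × ℝ × ℝ) {z : ℝ × ℝ × ℝ} (hz : z ∈ Ω) : dirDeriv v F z = 0 := by
  have : F =ᶠ[𝓝 z] fun _ => c := by
    filter_upwards [hΩ.mem_nhds hz] with y hy
    exact h y hy
  rw [(dirDeriv_congr this v).self_of_nhds, dirDeriv_const]

theorem exists_const_of_partials_eq_zero (hΩ : IsOpen Ω) (hc : IsConnected Ω)
    (hF : ContDiffOn ℝ ∞ F Ω) (h : ∀ z ∈ Ω, Pt F z = 0 ∧ Px F z = 0 ∧ Pu F z = 0) :
    ∃ c, ∀ z ∈ Ω, F z = c := by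
  refine hΩ.exists_is_const_of_fderiv_eq_zero hc.isPreconnected
    (hF.differentiableOn (by simp)) fun z hz => ?_
  obtain ⟨h1, h2, h3⟩ := h z hz
  refine ContinuousLinearMap.ext fun y => ?_
  rw [fderiv_apply_triple, h1, h2, h3]
  simp

theorem exists_affine_of_partials_eq_const (hΩ : IsOpen Ω) (hc : IsConnected Ω)
    (hF : ContDiffOn ℝ ∞ F Ω) {a b c : ℝ}
    (h : ∀ z ∈ Ω, Pt F z = a ∧ Px F z = b ∧ Pu F z = c) :
    ∃ d, ∀ z ∈ Ω, F z = a * z.1 + b * z.2.1 + c * z.2.2 + d := by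
  let l : ℝ × ℝ × ℝ →L[ℝ] ℝ :=
    a • ContinuousLinearMap.fst ℝ ℝ (ℝ × ℝ) +
      b • (ContinuousLinearMap.fst ℝ ℝ ℝ ∘L ContinuousLinearMap.snd ℝ ℝ (ℝ × ℝ)) +
      c • (ContinuousLinearMap.snd ℝ ℝ ℝ ∘L ContinuousLinearMap.snd ℝ ℝ (ℝ × ℝ))
  have hl : ∀ y, l y = a * y.1 + b * y.2.1 + c * y.2.2 := fun y => by simp [l]
  obtain ⟨d, hd⟩ := hΩ.exists_eq_add_of_fderiv_eq hc.isPreconnected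
    (hF.differentiableOn (by simp)) l.differentiable.differentiableOn fun z hz => by
      obtain ⟨h1, h2, h3⟩ := h z hz
      refine ContinuousLinearMap.ext fun y => ?_
      rw [fderiv_apply_triple, h1, h2, h3, l.fderiv, hl]
  exact ⟨d, fun z hz => (hd hz).trans (by simp only [hl])⟩

end Open

/-! ### Solving the determining equation -/

namespace IsAdmissible

variable {E E' : Equation} {Ω : Set (ℝ × ℝ × ℝ)} {Φ : ℝ × ℝ × ℝ → ℝ × ℝ × ℝ}

theorem smoothOn_compT (hA : IsAdmissible E E' Ω Φ) : ContDiffOn ℝ ∞ (compT Φ) Ω :=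
  fun _ hz => (hA.smoothAt hz).fst.contDiffWithinAt

theorem smoothOn_compX (hA : IsAdmissible E E' Ω Φ) : ContDiffOn ℝ ∞ (compX Φ) Ω :=
  fun _ hz => (hA.smoothAt hz).snd.fst.contDiffWithinAt

theorem smoothOn_compU (hA : IsAdmissible E E' Ω Φ) : ContDiffOn ℝ ∞ (compU Φ) Ω :=
  fun _ hz => (hA.smoothAt hz).snd.snd.contDiffWithinAt

theorem dirDeriv_comm (hA : IsAdmissible E E' Ω Φ) {F : ℝ × ℝ × ℝ → ℝ} (hF : ContDiffOn ℝ ∞ F Ω)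
    (v w : ℝ × ℝ × ℝ) {z : ℝ × ℝ × ℝ} (hz : z ∈ Ω) :
    dirDeriv v (dirDeriv w F) z = dirDeriv w (dirDeriv v F) z :=
  BBM.dirDeriv_comm ((hF.contDiffAt (hA.isOpen.mem_nhds hz)).of_le
    (by simpa using ENat.LEInfty.out)) v w

/-- Splitting with respect to `u_xx` at `u_t = 0`, with respect to `u_xx` at `u_t = 1`, and with
respect to `u_tx`. The constraint fixes `u_txx` from `u_t` and `u_x` alone, so it is the same for
the two jets subtracted in each case. -/
theorem second_partials (hA : IsAdmissible E E' Ω Φ) {z : ℝ × ℝ × ℝ} (hz : z ∈ Ω) :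
    Pt (Pu (compU Φ)) z = 0 ∧ Pu (Pu (compU Φ)) z = 0 ∧
      2 * Px (compX Φ) z * Pu (Px (compU Φ)) z = Px (Px (compX Φ)) z * Pu (compU Φ) z := by
  have hh := E.h_ne_zero _ (hA.source z hz)
  have hh' := E'.h_ne_zero _ (hA.target z hz)
  obtain ⟨-, r0, -⟩ := hA.partials_ne_zero hz
  have d0 := hA.determining hz 0 0 0 0 0 (by ring)
  have dc := hA.determining hz 0 0 1 0 0 (by ring)
  have de := hA.determining hz 0 0 0 1 0 (by ring)
  have da := hA.determining hz 1 0 0 0 (-1 / E.h z.1) (by field_simp; ring)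
  have dac := hA.determining hz 1 0 1 0 (-1 / E.h z.1) (by field_simp; ring)
  have h1 : Pt (Pu (compU Φ)) z = 0 := by
    have : E'.h (Φ z).1 * Px (compX Φ) z * Pt (Pu (compU Φ)) z = 0 := by
      linear_combination dc - d0
    exact (mul_eq_zero.1 this).resolve_left (mul_ne_zero hh' r0)
  refine ⟨h1, ?_, ?_⟩
  · have : E'.h (Φ z).1 * Px (compX Φ) z * Pu (Pu (compU Φ)) z = 0 := by
      linear_combination dac - da - E'.h (Φ z).1 * Px (compX Φ) z * h1
    exact (mul_eq_zero.1 this).resolve_left (mul_ne_zero hh' r0)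
  · have : E'.h (Φ z).1 * (2 * Px (compX Φ) z * Pu (Px (compU Φ)) z -
        Px (Px (compX Φ)) z * Pu (compU Φ) z) = 0 := by
      linear_combination de - d0
    exact sub_eq_zero.1 ((mul_eq_zero.1 this).resolve_left hh')

/-- The coefficient of `u_x`, where `u_txx = -(f + u) / h`. The other terms contain `U_tu`, `U_uu`
or their derivatives, which vanish on the whole domain; the common factor `X_x U_u` cancels. -/
theorem arbitrary_elements_relation (hA : IsAdmissible E E' Ω Φ) {z : ℝ × ℝ × ℝ} (hz : z ∈ Ω) :
    (E'.f (compT Φ z) + compU Φ z) * (Pt (compT Φ) z * Px (compX Φ) z * E.h z.1) =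
      E'.h (compT Φ z) * (E.f z.1 + z.2.2) := by
  have hh := E.h_ne_zero _ (hA.source z hz)
  obtain ⟨-, r0, U0⟩ := hA.partials_ne_zero hz
  obtain ⟨s1, s2, -⟩ := hA.second_partials hz
  have d0 := hA.determining hz 0 0 0 0 0 (by ring)
  have db := hA.determining hz 0 1 0 0 (-(E.f z.1 + z.2.2) / E.h z.1) (by field_simp; ring)
  have t1 : Pt (Pu (Pu (compU Φ))) z = 0 :=
    dirDeriv_eq_zero_of_eqOn_const hA.isOpen (fun y hy => (hA.second_partials hy).2.1) _ hz
  have t2 : Pt (Pu (Px (compU Φ))) z = 0 := by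
    have e1 : Pu (Px (compU Φ)) =ᶠ[𝓝 z] Px (Pu (compU Φ)) := by
      filter_upwards [hA.isOpen.mem_nhds hz] with y hy
      exact hA.dirDeriv_comm hA.smoothOn_compU _ _ hy
    have e2 : Pt (Px (Pu (compU Φ))) z = Px (Pt (Pu (compU Φ))) z :=
      hA.dirDeriv_comm (dirDeriv_smoothOn hA.isOpen hA.smoothOn_compU _) _ _ hz
    have e3 : Pt (Pu (Px (compU Φ))) z = Pt (Px (Pu (compU Φ))) z :=
      (dirDeriv_congr e1 _).self_of_nhds
    rw [e3, e2]
    exact dirDeriv_eq_zero_of_eqOn_const hA.isOpen (fun y hy => (hA.second_partials hy).1) _ hz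
  have key : Px (compX Φ) z * Pu (compU Φ) z *
      ((E'.f (Φ z).1 + (Φ z).2.2) * Pt (compT Φ) z * Px (compX Φ) z -
        E'.h (Φ z).1 * ((E.f z.1 + z.2.2) / E.h z.1)) = 0 := by
    rw [s1, s2, t1, t2] at db
    rw [s1, s2] at d0
    linear_combination db - d0
  have key' := (mul_eq_zero.1 key).resolve_left (mul_ne_zero r0 U0)
  change (E'.f (Φ z).1 + (Φ z).2.2) * (Pt (compT Φ) z * Px (compX Φ) z * E.h z.1) =
      E'.h (Φ z).1 * (E.f z.1 + z.2.2)
  field_simp at key'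
  linear_combination key'

theorem hasDirDeriv_target (hA : IsAdmissible E E' Ω Φ) {φ : ℝ → ℝ} (hφ : ContDiffOn ℝ ∞ φ E'.I)
    {v : ℝ × ℝ × ℝ} {z : ℝ × ℝ × ℝ} (hz : z ∈ Ω) (hv : dirDeriv v (compT Φ) z = 0) :
    HasDirDeriv v (fun y => φ (compT Φ y)) z 0 := by
  have h1 : DifferentiableAt ℝ φ (compT Φ z) :=
    (hφ.contDiffAt (E'.isOpen_I.mem_nhds (hA.target z hz))).differentiableAt (by simp)
  have h2 : DifferentiableAt ℝ (compT Φ) z := (hA.smoothAt hz).fst.differentiableAt (by simp)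
  exact ⟨h1.comp z h2, by rw [dirDeriv_real_comp h1 h2, hv, mul_zero]⟩

theorem hasDirDeriv_source (hA : IsAdmissible E E' Ω Φ) {φ : ℝ → ℝ} (hφ : ContDiffOn ℝ ∞ φ E.I)
    {v : ℝ × ℝ × ℝ} {z : ℝ × ℝ × ℝ} (hz : z ∈ Ω) (hv : v.1 = 0) :
    HasDirDeriv v (fun y => φ y.1) z 0 := by
  have h1 : DifferentiableAt ℝ φ z.1 :=
    (hφ.contDiffAt (E.isOpen_I.mem_nhds (hA.source z hz))).differentiableAt (by simp)
  refine ⟨h1.comp z differentiableAt_fst, ?_⟩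
  rw [dirDeriv_real_comp h1 differentiableAt_fst]
  simp [dirDeriv, fderiv_fst, hv]

theorem hasDirDeriv_self (hA : IsAdmissible E E' Ω Φ) {F : ℝ × ℝ × ℝ → ℝ}
    (hF : ContDiffOn ℝ ∞ F Ω) (v : ℝ × ℝ × ℝ) {z : ℝ × ℝ × ℝ} (hz : z ∈ Ω) :
    HasDirDeriv v F z (dirDeriv v F z) :=
  ⟨(hF.contDiffAt (hA.isOpen.mem_nhds hz)).differentiableAt (by simp), rfl⟩

theorem mixed_partials (hA : IsAdmissible E E' Ω Φ) {z : ℝ × ℝ × ℝ} (hz : z ∈ Ω) :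
    Px (Pt (compT Φ)) z = 0 ∧ Pu (Pt (compT Φ)) z = 0 ∧ Pt (Px (compX Φ)) z = 0 ∧
      Pu (Px (compX Φ)) z = 0 := by
  refine ⟨(hA.dirDeriv_comm hA.smoothOn_compT _ _ hz).trans ?_,
    (hA.dirDeriv_comm hA.smoothOn_compT _ _ hz).trans ?_,
    (hA.dirDeriv_comm hA.smoothOn_compX _ _ hz).trans ?_,
    (hA.dirDeriv_comm hA.smoothOn_compX _ _ hz).trans ?_⟩
  · exact dirDeriv_eq_zero_of_eqOn_const hA.isOpen (fun y hy => (hA.partials hy).1) _ hz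
  · exact dirDeriv_eq_zero_of_eqOn_const hA.isOpen (fun y hy => (hA.partials hy).2.1) _ hz
  · exact dirDeriv_eq_zero_of_eqOn_const hA.isOpen (fun y hy => (hA.partials hy).2.2.1) _ hz
  · exact dirDeriv_eq_zero_of_eqOn_const hA.isOpen (fun y hy => (hA.partials hy).2.2.2) _ hz

/-- Both sides of an identity that holds over the domain have the same directional derivatives. -/
theorem dirDeriv_eq_of_eqOn (hA : IsAdmissible E E' Ω Φ) {F G : ℝ × ℝ × ℝ → ℝ}
    (h : ∀ y ∈ Ω, F y = G y) {v z : ℝ × ℝ × ℝ} (hz : z ∈ Ω) {d d' : ℝ}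
    (hF : HasDirDeriv v F z d) (hG : HasDirDeriv v G z d') : d = d' := by
  have : F =ᶠ[𝓝 z] G := by
    filter_upwards [hA.isOpen.mem_nhds hz] with y hy
    exact h y hy
  rw [← hF.2, ← hG.2, (dirDeriv_congr this v).self_of_nhds]

theorem hasDirDeriv_coord (z v : ℝ × ℝ × ℝ) :
    HasDirDeriv v (fun y : ℝ × ℝ × ℝ => y.2.2) z v.2.2 := by
  have h : HasFDerivAt (fun y : ℝ × ℝ × ℝ => y.2.2) _ z :=
    (hasFDerivAt_id (𝕜 := ℝ) z).snd.snd
  refine ⟨h.differentiableAt, ?_⟩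
  rw [dirDeriv, h.fderiv]
  rfl

/-- The `u`-derivative of `arbitrary_elements_relation`: among its ingredients only `U` and the
explicit `u` depend on `u`. -/
theorem Pu_compU_relation (hA : IsAdmissible E E' Ω Φ) {z : ℝ × ℝ × ℝ} (hz : z ∈ Ω) :
    Pu (compU Φ) z * (Pt (compT Φ) z * Px (compX Φ) z * E.h z.1) = E'.h (compT Φ z) := by
  obtain ⟨-, m2, -, m4⟩ := hA.mixed_partials hz
  have hT := (hA.partials hz).2.1
  have hU := hA.hasDirDeriv_self hA.smoothOn_compU (0, 0, 1) hz
  have hp := hA.hasDirDeriv_self (F := Pt (compT Φ))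
    (dirDeriv_smoothOn hA.isOpen hA.smoothOn_compT _) (0, 0, 1) hz
  have hr := hA.hasDirDeriv_self (F := Px (compX Φ))
    (dirDeriv_smoothOn hA.isOpen hA.smoothOn_compX _) (0, 0, 1) hz
  have key := hA.dirDeriv_eq_of_eqOn (fun y hy => hA.arbitrary_elements_relation hy) hz
    (((hA.hasDirDeriv_target E'.smooth_f hz hT).add hU).mul
      ((hp.mul hr).mul (hA.hasDirDeriv_source E.smooth_h hz rfl)))
    ((hA.hasDirDeriv_target E'.smooth_h hz hT).mul
      ((hA.hasDirDeriv_source E.smooth_f hz rfl).add (hasDirDeriv_coord z _)))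
  have m2' : dirDeriv (0, 0, 1) (Pt (compT Φ)) z = 0 := m2
  have m4' : dirDeriv (0, 0, 1) (Px (compX Φ)) z = 0 := m4
  rw [m2', m4'] at key
  have e : Pu (compU Φ) z = dirDeriv (0, 0, 1) (compU Φ) z := rfl
  rw [e]
  linear_combination key

/-- The `x`-derivatives of `arbitrary_elements_relation` and `Pu_compU_relation`, combined with `2
X_x U_xu = X_xx U_u`. -/
theorem Px_compU_and_second (hA : IsAdmissible E E' Ω Φ) {z : ℝ × ℝ × ℝ} (hz : z ∈ Ω) :
    Px (compU Φ) z = 0 ∧ Px (Px (compX Φ)) z = 0 ∧ Px (Pu (compU Φ)) z = 0 := by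
  have hh := E.h_ne_zero _ (hA.source z hz)
  obtain ⟨p0, r0, U0⟩ := hA.partials_ne_zero hz
  obtain ⟨m1, -, -, -⟩ := hA.mixed_partials hz
  have hT := (hA.partials hz).1
  have m1' : dirDeriv (0, 1, 0) (Pt (compT Φ)) z = 0 := m1
  have hU := hA.hasDirDeriv_self hA.smoothOn_compU (0, 1, 0) hz
  have hUu := hA.hasDirDeriv_self (F := Pu (compU Φ))
    (dirDeriv_smoothOn hA.isOpen hA.smoothOn_compU _) (0, 1, 0) hz
  have hp := hA.hasDirDeriv_self (F := Pt (compT Φ))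
    (dirDeriv_smoothOn hA.isOpen hA.smoothOn_compT _) (0, 1, 0) hz
  have hr := hA.hasDirDeriv_self (F := Px (compX Φ))
    (dirDeriv_smoothOn hA.isOpen hA.smoothOn_compX _) (0, 1, 0) hz
  have key1 := hA.dirDeriv_eq_of_eqOn (fun y hy => hA.arbitrary_elements_relation hy) hz
    (((hA.hasDirDeriv_target E'.smooth_f hz hT).add hU).mul
      ((hp.mul hr).mul (hA.hasDirDeriv_source E.smooth_h hz rfl)))
    ((hA.hasDirDeriv_target E'.smooth_h hz hT).mul
      ((hA.hasDirDeriv_source E.smooth_f hz rfl).add (hasDirDeriv_coord z _)))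
  have key2 := hA.dirDeriv_eq_of_eqOn (fun y hy => hA.Pu_compU_relation hy) hz
    (hUu.mul ((hp.mul hr).mul (hA.hasDirDeriv_source E.smooth_h hz rfl)))
    (hA.hasDirDeriv_target E'.smooth_h hz hT)
  rw [m1'] at key1 key2
  have k3 := (hA.second_partials hz).2.2
  have hc : Pu (Px (compU Φ)) z = dirDeriv (0, 1, 0) (Pu (compU Φ)) z :=
    hA.dirDeriv_comm hA.smoothOn_compU _ _ hz
  rw [hc] at k3
  have es : Px (Px (compX Φ)) z = dirDeriv (0, 1, 0) (Px (compX Φ)) z := rfl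
  rw [es] at k3
  rw [es, show Px (compU Φ) z = dirDeriv (0, 1, 0) (compU Φ) z from rfl,
    show Px (Pu (compU Φ)) z = dirDeriv (0, 1, 0) (Pu (compU Φ)) z from rfl]
  set s := dirDeriv (0, 1, 0) (Px (compX Φ)) z
  -- The differentiated relation gives `X_x U_xu = -U_u X_xx`, whereas the splitting gives `2 X_x
  -- U_xu = X_xx U_u`; together `3 U_u X_xx = 0`.
  have hs : s = 0 := by
    have : Pt (compT Φ) z * E.h z.1 * Pu (compU Φ) z * s = 0 := by
      linear_combination (2 * key2 - Pt (compT Φ) z * E.h z.1 * k3) / 3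
    exact (mul_eq_zero.1 this).resolve_left (mul_ne_zero (mul_ne_zero p0 hh) U0)
  rw [hs] at key1 k3
  refine ⟨?_, hs, ?_⟩
  · have : Pt (compT Φ) z * Px (compX Φ) z * E.h z.1 * dirDeriv (0, 1, 0) (compU Φ) z = 0 := by
      linear_combination key1
    exact (mul_eq_zero.1 this).resolve_left (mul_ne_zero (mul_ne_zero p0 r0) hh)
  · have : Px (compX Φ) z * dirDeriv (0, 1, 0) (Pu (compU Φ)) z = 0 := by
      linear_combination k3 / 2
    exact (mul_eq_zero.1 this).resolve_left r0

/-- With `U_x = X_xx = 0`, the zero jet leaves `X_x³ U_t = 0`, and the coefficient of `u_t`, where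
`u_txx = -u_t / h`, leaves `X_x U_u (X_x² - h' / h) = 0`. -/
theorem Pt_compU_and_h (hA : IsAdmissible E E' Ω Φ) {z : ℝ × ℝ × ℝ} (hz : z ∈ Ω) :
    Pt (compU Φ) z = 0 ∧ E'.h (compT Φ z) = Px (compX Φ) z ^ 2 * E.h z.1 := by
  have hh := E.h_ne_zero _ (hA.source z hz)
  obtain ⟨-, r0, U0⟩ := hA.partials_ne_zero hz
  obtain ⟨x1, x2, -⟩ := hA.Px_compU_and_second hz
  have z1 : ∀ v, ∀ y ∈ Ω, dirDeriv v (Px (compU Φ)) y = 0 := fun v y hy =>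
    dirDeriv_eq_zero_of_eqOn_const hA.isOpen (fun w hw => (hA.Px_compU_and_second hw).1) v hy
  have z2 : ∀ v, dirDeriv v (Px (Px (compU Φ))) z = 0 := fun v =>
    dirDeriv_eq_zero_of_eqOn_const hA.isOpen (z1 (0, 1, 0)) v hz
  have e1 : Pt (Px (Px (compU Φ))) z = 0 := z2 _
  have e2 : Pu (Px (Px (compU Φ))) z = 0 := z2 _
  have d0 := hA.determining hz 0 0 0 0 0 (by ring)
  have da := hA.determining hz 1 0 0 0 (-1 / E.h z.1) (by field_simp; ring)
  rw [e1, e2, x1, x2] at d0 da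
  constructor
  · have : Px (compX Φ) z ^ 3 * Pt (compU Φ) z = 0 := by linear_combination d0
    exact (mul_eq_zero.1 this).resolve_left (pow_ne_zero 3 r0)
  · have : Px (compX Φ) z * Pu (compU Φ) z *
        (Px (compX Φ) z ^ 2 - E'.h (Φ z).1 / E.h z.1) = 0 := by
      linear_combination da - d0
    have key := (mul_eq_zero.1 this).resolve_left (mul_ne_zero r0 U0)
    change E'.h (Φ z).1 = _
    field_simp at key
    linear_combination -key

/-- Substituting `h' = X_x² h` into `Pu_compU_relation` and cancelling `X_x h`. This is the source
of the ratio `δ₁ / δ₃`. -/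
theorem Pu_compU_mul (hA : IsAdmissible E E' Ω Φ) {z : ℝ × ℝ × ℝ} (hz : z ∈ Ω) :
    Pu (compU Φ) z * Pt (compT Φ) z = Px (compX Φ) z := by
  have hh := E.h_ne_zero _ (hA.source z hz)
  obtain ⟨-, r0, -⟩ := hA.partials_ne_zero hz
  have h1 := hA.Pu_compU_relation hz
  rw [(hA.Pt_compU_and_h hz).2] at h1
  have : Px (compX Φ) z * E.h z.1 * (Pu (compU Φ) z * Pt (compT Φ) z - Px (compX Φ) z) = 0 := by
    linear_combination h1
  exact sub_eq_zero.1 ((mul_eq_zero.1 this).resolve_left (mul_ne_zero r0 hh))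

/-- The `t`-derivative of `U_u T_t = X_x`, in which `U_tu` and `X_tx` vanish. -/
theorem PtPt_compT (hA : IsAdmissible E E' Ω Φ) {z : ℝ × ℝ × ℝ} (hz : z ∈ Ω) :
    Pt (Pt (compT Φ)) z = 0 := by
  obtain ⟨-, -, U0⟩ := hA.partials_ne_zero hz
  have hUu := hA.hasDirDeriv_self (F := Pu (compU Φ))
    (dirDeriv_smoothOn hA.isOpen hA.smoothOn_compU _) (1, 0, 0) hz
  have hp := hA.hasDirDeriv_self (F := Pt (compT Φ))
    (dirDeriv_smoothOn hA.isOpen hA.smoothOn_compT _) (1, 0, 0) hz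
  have hr := hA.hasDirDeriv_self (F := Px (compX Φ))
    (dirDeriv_smoothOn hA.isOpen hA.smoothOn_compX _) (1, 0, 0) hz
  have key := hA.dirDeriv_eq_of_eqOn (fun y hy => hA.Pu_compU_mul hy) hz (hUu.mul hp) hr
  have m3 : dirDeriv (1, 0, 0) (Px (compX Φ)) z = 0 := (hA.mixed_partials hz).2.2.1
  have s1 : dirDeriv (1, 0, 0) (Pu (compU Φ)) z = 0 := (hA.second_partials hz).1
  rw [m3, s1, zero_mul, zero_add] at key
  exact (mul_eq_zero.1 key).resolve_left U0

/-- Each admissible transformation is affine, of the form of the equivalence group, and acts on the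
arbitrary elements in the corresponding way. -/
theorem exists_form (hA : IsAdmissible E E' Ω Φ) : ∃ δ₀ δ₁ δ₂ δ₃ δ₄ : ℝ, δ₁ * δ₃ ≠ 0 ∧
    ∀ z ∈ Ω, Φ z = (δ₁ / δ₃ * z.1 + δ₀, δ₁ * z.2.1 + δ₂, δ₃ * z.2.2 + δ₄) ∧
      E'.f (Φ z).1 = δ₃ * E.f z.1 - δ₄ ∧ E'.h (Φ z).1 = δ₁ ^ 2 * E.h z.1 := by
  obtain ⟨δ₁, hδ₁⟩ := exists_const_of_partials_eq_zero (F := Px (compX Φ)) hA.isOpen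
    hA.isConnected (dirDeriv_smoothOn hA.isOpen hA.smoothOn_compX _) fun z hz =>
      ⟨(hA.mixed_partials hz).2.2.1, (hA.Px_compU_and_second hz).2.1, (hA.mixed_partials hz).2.2.2⟩
  obtain ⟨α, hα⟩ := exists_const_of_partials_eq_zero (F := Pt (compT Φ)) hA.isOpen
    hA.isConnected (dirDeriv_smoothOn hA.isOpen hA.smoothOn_compT _) fun z hz =>
      ⟨hA.PtPt_compT hz, (hA.mixed_partials hz).1, (hA.mixed_partials hz).2.1⟩
  obtain ⟨δ₃, hδ₃⟩ := exists_const_of_partials_eq_zero (F := Pu (compU Φ)) hA.isOpen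
    hA.isConnected (dirDeriv_smoothOn hA.isOpen hA.smoothOn_compU _) fun z hz =>
      ⟨(hA.second_partials hz).1, (hA.Px_compU_and_second hz).2.2, (hA.second_partials hz).2.1⟩
  obtain ⟨δ₀, hδ₀⟩ := exists_affine_of_partials_eq_const hA.isOpen hA.isConnected
    hA.smoothOn_compT fun z hz => ⟨hα z hz, (hA.partials hz).1, (hA.partials hz).2.1⟩
  obtain ⟨δ₂, hδ₂⟩ := exists_affine_of_partials_eq_const hA.isOpen hA.isConnected
    hA.smoothOn_compX fun z hz => ⟨(hA.partials hz).2.2.1, hδ₁ z hz, (hA.partials hz).2.2.2⟩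
  obtain ⟨δ₄, hδ₄⟩ := exists_affine_of_partials_eq_const hA.isOpen hA.isConnected
    hA.smoothOn_compU fun z hz =>
      ⟨(hA.Pt_compU_and_h hz).1, (hA.Px_compU_and_second hz).1, hδ₃ z hz⟩
  obtain ⟨z₀, hz₀⟩ := hA.isConnected.nonempty
  obtain ⟨p0, r0, U0⟩ := hA.partials_ne_zero hz₀
  have hmul := hA.Pu_compU_mul hz₀
  rw [hα z₀ hz₀] at p0 hmul
  rw [hδ₁ z₀ hz₀] at r0 hmul
  rw [hδ₃ z₀ hz₀] at U0 hmul
  have hαδ : α = δ₁ / δ₃ := by rw [← hmul]; field_simp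
  refine ⟨δ₀, δ₁, δ₂, δ₃, δ₄, mul_ne_zero r0 U0, fun z hz => ⟨?_, ?_, ?_⟩⟩
  · refine Prod.ext ?_ (Prod.ext ?_ ?_)
    · exact (hδ₀ z hz).trans (by rw [hαδ]; ring)
    · exact (hδ₂ z hz).trans (by ring)
    · exact (hδ₄ z hz).trans (by ring)
  -- Inserting `h' = δ₁² h` and `U = δ₃ u + δ₄` into the relation between the arbitrary elements;
  -- since `δ₃ α = δ₁`, the terms with `u` cancel and the relation determines `f'`.
  · have hh := E.h_ne_zero _ (hA.source z hz)
    have h1 := hA.arbitrary_elements_relation hz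
    rw [(hA.Pt_compU_and_h hz).2, hα z hz, hδ₁ z hz, hδ₄ z hz] at h1
    have h2 : δ₁ * E.h z.1 * α * (E'.f (compT Φ z) - (δ₃ * E.f z.1 - δ₄)) = 0 := by
      linear_combination h1 - δ₁ * E.h z.1 * (E.f z.1 + z.2.2) * hmul
    exact sub_eq_zero.1 ((mul_eq_zero.1 h2).resolve_left (mul_ne_zero (mul_ne_zero r0 hh) p0))
  · rw [← hδ₁ z hz]
    exact (hA.Pt_compU_and_h hz).2

end IsAdmissible

/-! ### The affine transformations preserve the class -/

/-- The `(t, x, u)`-components of an element of the equivalence group. -/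
def affineMap (δ₀ δ₁ δ₂ δ₃ δ₄ : ℝ) (z : ℝ × ℝ × ℝ) : ℝ × ℝ × ℝ :=
  (δ₁ / δ₃ * z.1 + δ₀, δ₁ * z.2.1 + δ₂, δ₃ * z.2.2 + δ₄)

theorem affineMap_smooth (δ₀ δ₁ δ₂ δ₃ δ₄ : ℝ) : ContDiff ℝ ∞ (affineMap δ₀ δ₁ δ₂ δ₃ δ₄) := by
  unfold affineMap
  fun_prop

theorem fderiv_affineMap (δ₀ δ₁ δ₂ δ₃ δ₄ : ℝ) (z y : ℝ × ℝ × ℝ) :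
    fderiv ℝ (affineMap δ₀ δ₁ δ₂ δ₃ δ₄) z y = (δ₁ / δ₃ * y.1, δ₁ * y.2.1, δ₃ * y.2.2) := by
  have hid := hasFDerivAt_id (𝕜 := ℝ) z
  have h : HasFDerivAt (affineMap δ₀ δ₁ δ₂ δ₃ δ₄) _ z :=
    ((hid.fst.const_mul (δ₁ / δ₃)).add_const δ₀).prodMk
      (((hid.snd.fst.const_mul δ₁).add_const δ₂).prodMk ((hid.snd.snd.const_mul δ₃).add_const δ₄))
  rw [h.fderiv]
  rfl

theorem det_fderiv_affineMap_ne_zero (δ₀ δ₂ δ₄ : ℝ) {δ₁ δ₃ : ℝ} (hδ : δ₁ * δ₃ ≠ 0)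
    (z : ℝ × ℝ × ℝ) : (fderiv ℝ (affineMap δ₀ δ₁ δ₂ δ₃ δ₄) z).det ≠ 0 := by
  have h1 := left_ne_zero_of_mul hδ
  have h3 := right_ne_zero_of_mul hδ
  have hinj : Function.Injective
      (fderiv ℝ (affineMap δ₀ δ₁ δ₂ δ₃ δ₄) z : ℝ × ℝ × ℝ →ₗ[ℝ] ℝ × ℝ × ℝ) := by
    refine (injective_iff_map_eq_zero _).2 fun y hy => ?_
    have hy' := (fderiv_affineMap δ₀ δ₁ δ₂ δ₃ δ₄ z y).symm.trans hy
    simp only [Prod.mk_eq_zero, mul_eq_zero, div_eq_zero_iff, h1, h3, false_or] at hy'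
    exact Prod.ext hy'.1 (Prod.ext hy'.2.1 hy'.2.2)
  exact (LinearEquiv.isUnit_det' (LinearEquiv.ofInjectiveEndo _ hinj)).ne_zero

/-- The equation obtained from `E` by the equivalence transformation with the given parameters. -/
def Equation.transform (E : Equation) (δ₀ δ₁ δ₃ δ₄ : ℝ) (hδ : δ₁ * δ₃ ≠ 0) : Equation where
  I := (fun t => δ₁ / δ₃ * t + δ₀) '' E.I
  isOpen_I := by
    have h1 := left_ne_zero_of_mul hδ
    have h3 := right_ne_zero_of_mul hδ
    rw [Set.image_eq_preimage_of_inverse (g := fun s => (s - δ₀) * (δ₃ / δ₁))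
      (fun t => by field_simp; ring) (fun t => by field_simp; ring)]
    exact E.isOpen_I.preimage (by fun_prop)
  isConnected_I := E.isConnected_I.image _ (by fun_prop)
  f s := δ₃ * E.f ((s - δ₀) * (δ₃ / δ₁)) - δ₄
  h s := δ₁ ^ 2 * E.h ((s - δ₀) * (δ₃ / δ₁))
  smooth_f := by
    have h1 := left_ne_zero_of_mul hδ
    have h3 := right_ne_zero_of_mul hδ
    refine (contDiffOn_const.mul (E.smooth_f.comp (g := E.f)
      (f := fun s => (s - δ₀) * (δ₃ / δ₁)) (by fun_prop) ?_)).sub contDiffOn_const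
    rintro _ ⟨t, ht, rfl⟩
    have : (δ₁ / δ₃ * t + δ₀ - δ₀) * (δ₃ / δ₁) = t := by field_simp; ring
    simpa only [Set.mem_preimage, this] using ht
  smooth_h := by
    have h1 := left_ne_zero_of_mul hδ
    have h3 := right_ne_zero_of_mul hδ
    refine contDiffOn_const.mul (E.smooth_h.comp (g := E.h)
      (f := fun s => (s - δ₀) * (δ₃ / δ₁)) (by fun_prop) ?_)
    rintro _ ⟨t, ht, rfl⟩
    have : (δ₁ / δ₃ * t + δ₀ - δ₀) * (δ₃ / δ₁) = t := by field_simp; ring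
    simpa only [Set.mem_preimage, this] using ht
  h_ne_zero := by
    have h1 := left_ne_zero_of_mul hδ
    have h3 := right_ne_zero_of_mul hδ
    rintro _ ⟨t, ht, rfl⟩
    have : (δ₁ / δ₃ * t + δ₀ - δ₀) * (δ₃ / δ₁) = t := by field_simp; ring
    simp only [this]
    exact mul_ne_zero (pow_ne_zero 2 h1) (E.h_ne_zero t ht)

theorem Equation.transform_values (E : Equation) (δ₀ δ₁ δ₃ δ₄ : ℝ) (hδ : δ₁ * δ₃ ≠ 0) (t : ℝ) :
    (E.transform δ₀ δ₁ δ₃ δ₄ hδ).f (δ₁ / δ₃ * t + δ₀) = δ₃ * E.f t - δ₄ ∧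
    (E.transform δ₀ δ₁ δ₃ δ₄ hδ).h (δ₁ / δ₃ * t + δ₀) = δ₁ ^ 2 * E.h t := by
  have h1 := left_ne_zero_of_mul hδ
  have h3 := right_ne_zero_of_mul hδ
  have : (δ₁ / δ₃ * t + δ₀ - δ₀) * (δ₃ / δ₁) = t := by field_simp; ring
  simp only [Equation.transform, this, and_self]

theorem dirDeriv_affine {k : ℝ × ℝ → ℝ} {p : ℝ × ℝ} (hk : ContDiffAt ℝ 1 k p) (c d : ℝ)
    (v : ℝ × ℝ) :
    dirDeriv v (fun q => c * k q + d) =ᶠ[𝓝 p] fun q => c * dirDeriv v k q := by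
  filter_upwards [hk.eventually (by simp)] with q hq
  have h1 : HasDirDeriv v k q (dirDeriv v k q) := ⟨hq.differentiableAt (by simp), rfl⟩
  have h2 : HasDirDeriv v (fun _ => d) q 0 := ⟨differentiableAt_const d, dirDeriv_const d v q⟩
  exact ((h1.const_mul c).add h2).2.trans (add_zero _)

theorem derivs_affine {u : ℝ × ℝ → ℝ} {p : ℝ × ℝ} (hu : ContDiffAt ℝ 3 u p) (c d : ℝ) :
    Dt (fun q => c * u q + d) p = c * Dt u p ∧ Dx (fun q => c * u q + d) p = c * Dx u p ∧
      Dt (Dx (Dx fun q => c * u q + d)) p = c * Dt (Dx (Dx u)) p := by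
  have u1 : ContDiffAt ℝ 1 u p := hu.of_le (by norm_num)
  have ux : ContDiffAt ℝ 2 (Dx u) p := Dx_smooth hu (by norm_num)
  have uxx : ContDiffAt ℝ 1 (Dx (Dx u)) p := Dx_smooth ux (by norm_num)
  have ex : Dx (fun q => c * u q + d) =ᶠ[𝓝 p] fun q => c * Dx u q + 0 := by
    simp only [add_zero]
    exact dirDeriv_affine u1 c d (0, 1)
  have exx : Dx (Dx fun q => c * u q + d) =ᶠ[𝓝 p] fun q => c * Dx (Dx u) q + 0 := by
    refine (Dx_congr ex).trans ?_
    simp only [add_zero]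
    simpa only [add_zero, ← Dx_eq] using! dirDeriv_affine (ux.of_le (by norm_num)) c 0 (0, 1)
  refine ⟨(dirDeriv_affine u1 c d (1, 0)).self_of_nhds,
    (dirDeriv_affine u1 c d (0, 1)).self_of_nhds, ?_⟩
  rw [(Dt_congr exx).self_of_nhds]
  exact (dirDeriv_affine uxx c 0 (1, 0)).self_of_nhds

/-- The derivatives scale as `v_t = (δ₃² / δ₁) u_t`, `v_x = (δ₃ / δ₁) u_x` and `v_txx = (δ₃² / δ₁³)
u_txx`, and the shift `δ₄` cancels between `f` and `u`. The target left-hand side is thus `δ₃² / δ₁`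
times the source one. -/
theorem mapsEquation_transform {Ω : Set (ℝ × ℝ × ℝ)} (hΩ : IsOpen Ω)
    {Φ : ℝ × ℝ × ℝ → ℝ × ℝ × ℝ} {δ₀ δ₁ δ₂ δ₃ δ₄ : ℝ} (hδ : δ₁ * δ₃ ≠ 0)
    (hΦ : ∀ z ∈ Ω, Φ z = affineMap δ₀ δ₁ δ₂ δ₃ δ₄ z) (E : Equation) :
    MapsEquation Ω Φ E (E.transform δ₀ δ₁ δ₃ δ₄ hδ) := by
  intro u v p p' hp hp' hu hv hm
  have h1 := left_ne_zero_of_mul hδ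
  have h3 := right_ne_zero_of_mul hδ
  have three : (3 : WithTop ℕ∞) ≤ ∞ := by simpa using ENat.LEInfty.out
  -- Writing the affine functions as instances of `jetPoly` makes their derivatives available from
  -- the formulas above.
  set φ₁ := jetPoly 0 δ₀ (δ₁ / δ₃) 0 0 0 0 0 0 0 with hφ₁
  set φ₂ := jetPoly 0 δ₂ 0 δ₁ 0 0 0 0 0 0 with hφ₂
  have e₁ : ∀ q, φ₁ q = δ₁ / δ₃ * q.1 + δ₀ := fun q => by simp [hφ₁, jetPoly]; ring
  have e₂ : ∀ q, φ₂ q = δ₁ * q.2 + δ₂ := fun q => by simp [hφ₂, jetPoly]; ring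
  have near : ∀ᶠ q in 𝓝 p, graphMap u q ∈ Ω :=
    (graphMap_smooth hu).continuousAt.eventually (hΩ.mem_nhds hp)
  have hpe : p' = (φ₁ p, φ₂ p) := by
    rw [hp', hΦ _ hp, e₁, e₂]
    rfl
  have hg : (fun q => δ₃ * u q + δ₄) =ᶠ[𝓝 p] fun q => v (φ₁ q, φ₂ q) := by
    filter_upwards [near, hm] with q hq hmq
    rw [show (q.1, q.2, u q) = graphMap u q from rfl, hΦ _ hq] at hmq
    rw [e₁, e₂]
    exact hmq.symm
  have hDt1 : Dt φ₁ p = δ₁ / δ₃ := by simp [hφ₁, Dt_jetPoly]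
  have hDx2 : Dx φ₂ p = δ₁ := by simp [hφ₂, Dx_jetPoly]
  have hDxx2 : Dx (Dx φ₂) p = 0 := by simp [hφ₂, DxDx_jetPoly, jetPoly]
  rw [hpe] at hv ⊢
  obtain ⟨g1, g2, -, g4⟩ := derivs_comp_separated
    ((jetPoly_smooth ..).contDiffAt.of_le three) ((jetPoly_smooth ..).contDiffAt.of_le three)
    (hv.of_le three) (Eventually.of_forall fun q => by simp [Dx_jetPoly])
    (Eventually.of_forall fun q => by simp [Dt_jetPoly]) hg
  obtain ⟨k1, k2, k4⟩ := derivs_affine (hu.of_le three) δ₃ δ₄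
  rw [k1, hDt1] at g1
  rw [k2, hDx2] at g2
  rw [k4, hDt1, hDx2, hDxx2] at g4
  have hv0 : v (φ₁ p, φ₂ p) = δ₃ * u p + δ₄ := hg.self_of_nhds.symm
  obtain ⟨tf, th⟩ := E.transform_values δ₀ δ₁ δ₃ δ₄ hδ p.1
  have g1' : Dt v (φ₁ p, φ₂ p) = δ₃ ^ 2 / δ₁ * Dt u p := by
    field_simp at g1 ⊢
    linear_combination -g1
  have g2' : Dx v (φ₁ p, φ₂ p) = δ₃ / δ₁ * Dx u p := by
    field_simp at g2 ⊢
    linear_combination -g2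
  have g4' : Dt (Dx (Dx v)) (φ₁ p, φ₂ p) = δ₃ ^ 2 / δ₁ ^ 3 * Dt (Dx (Dx u)) p := by
    field_simp at g4 ⊢
    linear_combination -g4
  have hφ1p : (φ₁ p, φ₂ p).1 = δ₁ / δ₃ * p.1 + δ₀ := e₁ p
  rw [Equation.HoldsAt, Equation.HoldsAt, g1', g2', g4', hv0, hφ1p, tf, th]
  have : δ₃ ^ 2 / δ₁ * Dt u p + (δ₃ * E.f p.1 - δ₄) * (δ₃ / δ₁ * Dx u p) +
      (δ₃ * u p + δ₄) * (δ₃ / δ₁ * Dx u p) +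
      δ₁ ^ 2 * E.h p.1 * (δ₃ ^ 2 / δ₁ ^ 3 * Dt (Dx (Dx u)) p) =
      δ₃ ^ 2 / δ₁ *
        (Dt u p + E.f p.1 * Dx u p + u p * Dx u p + E.h p.1 * Dt (Dx (Dx u)) p) := by
    field_simp
    ring
  rw [this, mul_eq_zero]
  simp [h1, h3]

theorem isUsualEquivalenceOn_of_form {Ω : Set (ℝ × ℝ × ℝ)} (hΩ : IsOpen Ω)
    {Φ : ℝ × ℝ × ℝ → ℝ × ℝ × ℝ} {A : ℝ × ℝ × ℝ → ℝ × ℝ → ℝ × ℝ} {δ₀ δ₁ δ₂ δ₃ δ₄ : ℝ}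
    (hδ : δ₁ * δ₃ ≠ 0) (hΦ : ∀ z ∈ Ω, Φ z = affineMap δ₀ δ₁ δ₂ δ₃ δ₄ z)
    (hA : ∀ z ∈ Ω, ∀ f h : ℝ, h ≠ 0 → A z (f, h) = (δ₃ * f - δ₄, δ₁ ^ 2 * h)) :
    IsUsualEquivalenceOn Ω Φ A where
  point :=
    { smooth := (affineMap_smooth δ₀ δ₁ δ₂ δ₃ δ₄).contDiffOn.congr hΦ
      jacobian_ne_zero := fun z hz => by
        have : Φ =ᶠ[𝓝 z] affineMap δ₀ δ₁ δ₂ δ₃ δ₄ := by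
          filter_upwards [hΩ.mem_nhds hz] with y hy
          exact hΦ y hy
        rw [this.fderiv_eq]
        exact det_fderiv_affineMap_ne_zero _ _ _ hδ z }
  maps E := by
    refine ⟨E.transform δ₀ δ₁ δ₃ δ₄ hδ, fun z hz hzI => ⟨?_, ?_⟩, ?_⟩
    · rw [hΦ z hz]
      exact ⟨z.1, hzI, rfl⟩
    · rw [hA z hz _ _ (E.h_ne_zero _ hzI), hΦ z hz]
      obtain ⟨tf, th⟩ := E.transform_values δ₀ δ₁ δ₃ δ₄ hδ z.1
      exact Prod.ext tf.symm th.symm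
    · exact mapsEquation_transform (hΩ.inter (E.isOpen_I.preimage continuous_fst)) hδ
        (fun z hz => hΦ z hz.1) E

/-! ### Usual equivalence transformations over a domain -/

/-- The equation with constant arbitrary elements on the whole line. -/
def constEquation (f h : ℝ) (hh : h ≠ 0) : Equation where
  I := Set.univ
  isOpen_I := isOpen_univ
  isConnected_I := isConnected_univ
  f _ := f
  h _ := h
  smooth_f := contDiffOn_const
  smooth_h := contDiffOn_const
  h_ne_zero _ _ := hh

/-- Comparing values at two points of the open set that differ by a multiple of `(1, 1, 1)` gives
the slopes. Only the parameters that act on `(f, h)` are needed. -/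
theorem affine_coeffs_unique {Ω : Set (ℝ × ℝ × ℝ)} (hΩ : IsOpen Ω) (hne : Ω.Nonempty)
    {δ₀ δ₁ δ₂ δ₃ δ₄ ε₀ ε₁ ε₂ ε₃ ε₄ : ℝ}
    (h : ∀ z ∈ Ω, affineMap δ₀ δ₁ δ₂ δ₃ δ₄ z = affineMap ε₀ ε₁ ε₂ ε₃ ε₄ z) :
    δ₁ = ε₁ ∧ δ₃ = ε₃ ∧ δ₄ = ε₄ := by
  obtain ⟨z, hz⟩ := hne
  have hc : Continuous fun s : ℝ => z + s • ((1, 1, 1) : ℝ × ℝ × ℝ) := by fun_prop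
  have hev : ∀ᶠ s in 𝓝[≠] (0 : ℝ), z + s • ((1, 1, 1) : ℝ × ℝ × ℝ) ∈ Ω := by
    refine nhdsWithin_le_nhds (hc.tendsto 0 (hΩ.mem_nhds ?_))
    simpa using hz
  obtain ⟨s, hs, hs0⟩ := (hev.and self_mem_nhdsWithin).exists
  have a1 := h z hz
  have a2 := h _ hs
  simp only [affineMap, Prod.fst_add, Prod.snd_add, Prod.smul_mk, smul_eq_mul, mul_one,
    Prod.mk.injEq] at a1 a2
  obtain ⟨-, b1, c1⟩ := a1
  obtain ⟨-, b2, c2⟩ := a2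
  have e1 : δ₁ = ε₁ := mul_right_cancel₀ hs0 (by linear_combination b2 - b1)
  have e3 : δ₃ = ε₃ := mul_right_cancel₀ hs0 (by linear_combination c2 - c1)
  refine ⟨e1, e3, ?_⟩
  rw [e3] at c1
  linarith

/-- Each constant equation lives over all of `Ω`, so it makes `Φ` an admissible transformation with
affine form. The parameters could depend on the chosen constants, but `Φ` does not; uniqueness of
the coefficients identifies the relevant ones with those of the reference equation `f = 0`, `h = 1`.
-/
theorem IsUsualEquivalenceOn.exists_form {Ω : Set (ℝ × ℝ × ℝ)} (hΩ : IsOpen Ω)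
    (hc : IsConnected Ω) {Φ : ℝ × ℝ × ℝ → ℝ × ℝ × ℝ} {A : ℝ × ℝ × ℝ → ℝ × ℝ → ℝ × ℝ}
    (h : IsUsualEquivalenceOn Ω Φ A) : ∃ δ₀ δ₁ δ₂ δ₃ δ₄ : ℝ, δ₁ * δ₃ ≠ 0 ∧
      ∀ z ∈ Ω, Φ z = affineMap δ₀ δ₁ δ₂ δ₃ δ₄ z ∧
        ∀ f h : ℝ, h ≠ 0 → A z (f, h) = (δ₃ * f - δ₄, δ₁ ^ 2 * h) := by
  have key : ∀ f k : ℝ, k ≠ 0 → ∃ δ₀ δ₁ δ₂ δ₃ δ₄ : ℝ, δ₁ * δ₃ ≠ 0 ∧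
      ∀ z ∈ Ω, Φ z = affineMap δ₀ δ₁ δ₂ δ₃ δ₄ z ∧ A z (f, k) = (δ₃ * f - δ₄, δ₁ ^ 2 * k) := by
    intro f k hk
    obtain ⟨E', hE', hmaps⟩ := h.maps (constEquation f k hk)
    have hset : {z | z ∈ Ω ∧ z.1 ∈ (constEquation f k hk).I} = Ω :=
      Set.ext fun z => and_iff_left (Set.mem_univ _)
    rw [hset] at hmaps
    have hadm : IsAdmissible (constEquation f k hk) E' Ω Φ :=
      ⟨hΩ, hc, h.point, fun _ _ => Set.mem_univ _,
        fun z hz => (hE' z hz (Set.mem_univ _)).1, hmaps⟩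
    obtain ⟨δ₀, δ₁, δ₂, δ₃, δ₄, hδ, hform⟩ := hadm.exists_form
    refine ⟨δ₀, δ₁, δ₂, δ₃, δ₄, hδ, fun z hz => ⟨(hform z hz).1, ?_⟩⟩
    refine ((hE' z hz (Set.mem_univ _)).2).trans ?_
    rw [(hform z hz).2.1, (hform z hz).2.2]
    rfl
  obtain ⟨δ₀, δ₁, δ₂, δ₃, δ₄, hδ, hform⟩ := key 0 1 one_ne_zero
  refine ⟨δ₀, δ₁, δ₂, δ₃, δ₄, hδ, fun z hz => ⟨(hform z hz).1, fun f k hk => ?_⟩⟩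
  obtain ⟨ε₀, ε₁, ε₂, ε₃, ε₄, -, hform'⟩ := key f k hk
  obtain ⟨e1, e3, e4⟩ := affine_coeffs_unique hΩ hc.nonempty fun y hy =>
    (hform y hy).1.symm.trans (hform' y hy).1
  rw [e1, e3, e4]
  exact (hform' z hz).2

/-! ### The group acting on the extended space, and normalization -/

theorem ExtSpace.ext_of {p q : ExtSpace} (ht : p.t = q.t) (hx : p.x = q.x) (hu : p.u = q.u)
    (hf : p.f = q.f) (hh : p.h = q.h) : p = q := by
  cases p
  cases q
  simp_all

/-- The element of the equivalence group with the given parameters. -/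
def extPerm (δ₀ δ₁ δ₂ δ₃ δ₄ : ℝ) (hδ : δ₁ * δ₃ ≠ 0) : Equiv.Perm ExtSpace where
  toFun p := ⟨δ₁ / δ₃ * p.t + δ₀, δ₁ * p.x + δ₂, δ₃ * p.u + δ₄, δ₃ * p.f - δ₄, δ₁ ^ 2 * p.h,
    mul_ne_zero (pow_ne_zero 2 (left_ne_zero_of_mul hδ)) p.h_ne_zero⟩
  invFun p := ⟨(p.t - δ₀) * (δ₃ / δ₁), (p.x - δ₂) / δ₁, (p.u - δ₄) / δ₃, (p.f + δ₄) / δ₃,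
    p.h / δ₁ ^ 2, div_ne_zero p.h_ne_zero (pow_ne_zero 2 (left_ne_zero_of_mul hδ))⟩
  left_inv p := by
    have h1 := left_ne_zero_of_mul hδ
    have h3 := right_ne_zero_of_mul hδ
    refine ExtSpace.ext_of ?_ ?_ ?_ ?_ ?_ <;> field_simp <;> ring
  right_inv p := by
    have h1 := left_ne_zero_of_mul hδ
    have h3 := right_ne_zero_of_mul hδ
    refine ExtSpace.ext_of ?_ ?_ ?_ ?_ ?_ <;> field_simp <;> ring

theorem hasForm_extPerm (δ₀ δ₁ δ₂ δ₃ δ₄ : ℝ) (hδ : δ₁ * δ₃ ≠ 0) :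
    HasForm (extPerm δ₀ δ₁ δ₂ δ₃ δ₄ hδ) δ₀ δ₁ δ₂ δ₃ δ₄ :=
  fun _ => ⟨rfl, rfl, rfl, rfl, rfl⟩

theorem HasForm.mul {g g' : Equiv.Perm ExtSpace} {δ₀ δ₁ δ₂ δ₃ δ₄ ε₀ ε₁ ε₂ ε₃ ε₄ : ℝ}
    (hg : HasForm g δ₀ δ₁ δ₂ δ₃ δ₄) (hg' : HasForm g' ε₀ ε₁ ε₂ ε₃ ε₄) :
    HasForm (g * g') (δ₁ / δ₃ * ε₀ + δ₀) (δ₁ * ε₁) (δ₁ * ε₂ + δ₂) (δ₃ * ε₃) (δ₃ * ε₄ + δ₄) := by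
  intro p
  obtain ⟨a1, a2, a3, a4, a5⟩ := hg' p
  obtain ⟨b1, b2, b3, b4, b5⟩ := hg (g' p)
  rw [a1] at b1
  rw [a2] at b2
  rw [a3] at b3
  rw [a4] at b4
  rw [a5] at b5
  rw [Equiv.Perm.mul_apply, b1, b2, b3, b4, b5, mul_div_mul_comm]
  exact ⟨by ring, by ring, by ring, by ring, by ring⟩

theorem HasForm.inv {g : Equiv.Perm ExtSpace} {δ₀ δ₁ δ₂ δ₃ δ₄ : ℝ} (hδ : δ₁ * δ₃ ≠ 0)
    (hg : HasForm g δ₀ δ₁ δ₂ δ₃ δ₄) :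
    HasForm g⁻¹ (-(δ₃ / δ₁ * δ₀)) δ₁⁻¹ (-(δ₂ / δ₁)) δ₃⁻¹ (-(δ₄ / δ₃)) := by
  intro p
  have h1 := left_ne_zero_of_mul hδ
  have h3 := right_ne_zero_of_mul hδ
  -- The formulas at `g⁻¹ p` express the coordinates of `p` through those of `g⁻¹ p`; solving them
  -- gives the inverse parameters.
  have hp := hg (g⁻¹ p)
  rw [← Equiv.Perm.mul_apply, mul_inv_cancel, Equiv.Perm.one_apply] at hp
  obtain ⟨b1, b2, b3, b4, b5⟩ := hp
  rw [b1, b2, b3, b4, b5]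
  refine ⟨?_, ?_, ?_, ?_, ?_⟩ <;> field_simp <;> ring

theorem isUsualEquivalence_iff (g : Equiv.Perm ExtSpace) :
    IsUsualEquivalence g ↔
      ∃ δ₀ δ₁ δ₂ δ₃ δ₄ : ℝ, δ₁ * δ₃ ≠ 0 ∧ HasForm g δ₀ δ₁ δ₂ δ₃ δ₄ := by
  constructor
  · rintro ⟨Φ, A, hΦ, hg⟩
    obtain ⟨δ₀, δ₁, δ₂, δ₃, δ₄, hδ, hform⟩ := hΦ.exists_form isOpen_univ isConnected_univ
    refine ⟨δ₀, δ₁, δ₂, δ₃, δ₄, hδ, fun p => ?_⟩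
    obtain ⟨h1, h2⟩ := hg p
    obtain ⟨k1, k2⟩ := hform (p.t, p.x, p.u) (Set.mem_univ _)
    rw [k1, affineMap] at h1
    rw [k2 _ _ p.h_ne_zero] at h2
    simp only [Prod.mk.injEq] at h1 h2
    exact ⟨h1.1, h1.2.1, h1.2.2, h2.1, h2.2⟩
  · rintro ⟨δ₀, δ₁, δ₂, δ₃, δ₄, hδ, hg⟩
    refine ⟨affineMap δ₀ δ₁ δ₂ δ₃ δ₄, fun _ w => (δ₃ * w.1 - δ₄, δ₁ ^ 2 * w.2),
      isUsualEquivalenceOn_of_form isOpen_univ hδ (fun _ _ => rfl) fun _ _ _ _ _ => rfl,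
      fun p => ?_⟩
    obtain ⟨b1, b2, b3, b4, b5⟩ := hg p
    rw [b1, b2, b3, b4, b5]
    exact ⟨rfl, rfl⟩

theorem isNormalized : IsNormalized := by
  intro E E' Ω Φ hA
  obtain ⟨δ₀, δ₁, δ₂, δ₃, δ₄, hδ, hform⟩ := hA.exists_form
  have hg := hasForm_extPerm δ₀ δ₁ δ₂ δ₃ δ₄ hδ
  refine ⟨extPerm δ₀ δ₁ δ₂ δ₃ δ₄ hδ,
    (isUsualEquivalence_iff _).2 ⟨δ₀, δ₁, δ₂, δ₃, δ₄, hδ, hg⟩, fun p hp hf hh => ?_⟩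
  obtain ⟨b1, b2, b3, b4, b5⟩ := hg p
  obtain ⟨k1, k2, k3⟩ := hform _ hp
  rw [k1] at k2 k3
  rw [b1, b2, b3, b4, b5, k1, hf, hh]
  exact ⟨rfl, k2.symm, k3.symm⟩

/-- The usual equivalence group of the class. -/
def equivalenceGroup : Subgroup (Equiv.Perm ExtSpace) where
  carrier := {g | ∃ δ₀ δ₁ δ₂ δ₃ δ₄ : ℝ, δ₁ * δ₃ ≠ 0 ∧ HasForm g δ₀ δ₁ δ₂ δ₃ δ₄}
  mul_mem' := by
    rintro g g' ⟨δ₀, δ₁, δ₂, δ₃, δ₄, hδ, hg⟩ ⟨ε₀, ε₁, ε₂, ε₃, ε₄, hε, hg'⟩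
    refine ⟨_, _, _, _, _, ?_, hg.mul hg'⟩
    rw [mul_mul_mul_comm]
    exact mul_ne_zero hδ hε
  one_mem' := ⟨0, 1, 0, 1, 0, by norm_num, fun p => by simp⟩
  inv_mem' := by
    rintro g ⟨δ₀, δ₁, δ₂, δ₃, δ₄, hδ, hg⟩
    refine ⟨_, _, _, _, _, ?_, hg.inv hδ⟩
    rw [← mul_inv]
    exact inv_ne_zero hδ

end BBM

end

theorem corollary2 :
    -- the class is normalized in the usual sense
    BBM.IsNormalized ∧
    -- the usual equivalence transformations form a group, which consists exactly of the
    -- transformations of the given form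
    (∃ G : Subgroup (Equiv.Perm BBM.ExtSpace),
      (∀ g, g ∈ G ↔ BBM.IsUsualEquivalence g) ∧
      (∀ g, g ∈ G ↔ ∃ δ₀ δ₁ δ₂ δ₃ δ₄ : ℝ, δ₁ * δ₃ ≠ 0 ∧ BBM.HasForm g δ₀ δ₁ δ₂ δ₃ δ₄) ∧
      (∀ δ₀ δ₁ δ₂ δ₃ δ₄ : ℝ, δ₁ * δ₃ ≠ 0 → ∃ g ∈ G, BBM.HasForm g δ₀ δ₁ δ₂ δ₃ δ₄)) ∧
    -- equivalence transformations defined only over a domain are restrictions of these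
    (∀ Ω : Set (ℝ × ℝ × ℝ), IsOpen Ω → IsConnected Ω →
      ∀ (Φ : ℝ × ℝ × ℝ → ℝ × ℝ × ℝ) (A : ℝ × ℝ × ℝ → ℝ × ℝ → ℝ × ℝ),
        BBM.IsUsualEquivalenceOn Ω Φ A ↔
          ∃ δ₀ δ₁ δ₂ δ₃ δ₄ : ℝ, δ₁ * δ₃ ≠ 0 ∧ ∀ t x u : ℝ, (t, x, u) ∈ Ω →
            Φ (t, x, u) = (δ₁ / δ₃ * t + δ₀, δ₁ * x + δ₂, δ₃ * u + δ₄) ∧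
            ∀ f h : ℝ, h ≠ 0 → A (t, x, u) (f, h) = (δ₃ * f - δ₄, δ₁ ^ 2 * h)) := by
  refine ⟨BBM.isNormalized, ⟨BBM.equivalenceGroup, fun g => (BBM.isUsualEquivalence_iff g).symm,
    fun g => Iff.rfl, fun δ₀ δ₁ δ₂ δ₃ δ₄ hδ => ?_⟩, fun Ω hΩ hc Φ A => ⟨fun h => ?_, ?_⟩⟩
  · exact ⟨BBM.extPerm δ₀ δ₁ δ₂ δ₃ δ₄ hδ,
      ⟨δ₀, δ₁, δ₂, δ₃, δ₄, hδ, BBM.hasForm_extPerm δ₀ δ₁ δ₂ δ₃ δ₄ hδ⟩,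
      BBM.hasForm_extPerm δ₀ δ₁ δ₂ δ₃ δ₄ hδ⟩
  · obtain ⟨δ₀, δ₁, δ₂, δ₃, δ₄, hδ, hform⟩ := h.exists_form hΩ hc
    exact ⟨δ₀, δ₁, δ₂, δ₃, δ₄, hδ, fun t x u hz => hform (t, x, u) hz⟩
  · rintro ⟨δ₀, δ₁, δ₂, δ₃, δ₄, hδ, hform⟩
    exact BBM.isUsualEquivalenceOn_of_form hΩ hδ (fun z hz => (hform z.1 z.2.1 z.2.2 hz).1)
      fun z hz => (hform z.1 z.2.1 z.2.2 hz).2
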